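/- Write $\mathbb D_-=\{|z|>1\}\cup\{\infty\}$. Let $\Sigma'$ be the class of univalent maps $\phi:\mathbb D_-\to\mathbb D_-$ with $\phi(\infty)=\infty$ and $\phi'(\infty)$ real and positive, i.e. $\phi(z)=b_1z+\dots$ at infinity with $b_1>0$. For $\phi\in\Sigma'$ put $\phi_\theta(z)=e^{i\theta}\phi(ze^{-i\theta})$, and let $(K_n\phi)(z)=\sqrt[n]{\phi(z^n)}$ be the Koebe transform (the holomorphic branch on $\mathbb D_-$ with positive derivative at $\infty$). Fix $\phi\in\Sigma'$ and an integer $k\ge2$, put $\psi=\phi^{-1}:\phi(\mathbb D_-)\to\mathbb D_-$, and let $\theta_0,\theta_1,\dots$ be independent random variables uniformly distributed on $[-\pi,\pi]$. The random conformal snowflake is $f=\lim_{n\to\infty} f_n$ on $\mathbb D_-$, where $f_0=\phi_{\theta_0}$ and $f_n=f_{n-1}\circ K_{k^n}\phi_{\theta_n}$; put $g=f^{-1}:f(\mathbb D_-)\to\mathbb D_-$. Let $t,\beta\in\mathbb R$, $\tau=2-t$, $\sigma=\beta-1$, and for $r>1$ $$F(r)=\mathbb E\left[\left|\frac{g'(r)}{g(r)}\right|^{\tau}\log^{\sigma}|g(r)|\right]\in[0,\infty],$$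 where the quantity in brackets is taken to be $0$ when $r\notin f(\mathbb D_-)$. Let $\mathcal L$ be the class of (finite, measurable) functions on $(1,\infty)$ that are bounded on compact subsets of $(1,\infty)$ and integrable in a neighbourhood of $1$. **Lemma.** If $F\in\mathcal L$, then for every $r>1$ $$F(r)=\frac1{k^{\sigma}}\int_{-\pi}^{\pi}F\left(|\psi^k(re^{i\theta})|\right)\left|\psi^{k-1}(re^{i\theta})\,\psi'(re^{i\theta})\right|^{\tau}\frac{d\theta}{2\pi},$$ where $\psi^j$ denotes the $j$-th power of $\psi$, the integrand is taken to be $0$ when $re^{i\theta}\notin\phi(\mathbb D_-)$, and the integral converges absolutely. Equivalently, $k^{\beta}F=QF$ on $(1,\infty)$, where $$Qf(r)=k\int_{-\pi}^{\pi}f\left(|\psi^k(re^{i\theta})|\right)\left|\psi^{k-1}(re^{i\theta})\,\psi'(re^{i\theta})\right|^{\tau}\frac{d\theta}{2\pi}$$ (with the same convention). -/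

import Mathlib

namespace Snowflake

open Filter Topology MeasureTheory

/-- The finite part `{z : 1 < |z|}` of the exterior `𝔻₋` of the closed unit disc. -/
def extDisk : Set ℂ := {z | 1 < ‖z‖}

/-- The class `Σ'`: univalent maps `φ : 𝔻₋ → 𝔻₋` with `φ(∞) = ∞` and `φ'(∞) = b` real and positive,
i.e. `φ(z) = b z + …` at infinity. Only the values of `φ` on `𝔻₋` matter. -/
structure IsSigma (φ : ℂ → ℂ) : Prop where
  differentiableOn : DifferentiableOn ℂ φ extDisk
  injOn : Set.InjOn φ extDisk
  mapsTo : Set.MapsTo φ extDisk extDisk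
  deriv_infty : ∃ b : ℝ, 0 < b ∧ Tendsto (fun z => φ z / z) (Bornology.cobounded ℂ) (𝓝 (b : ℂ))

/-- The rotated map `φ_θ(z) = e^{iθ} φ(z e^{-iθ})`. -/
noncomputable def rot (φ : ℂ → ℂ) (θ : ℝ) (z : ℂ) : ℂ :=
  Complex.exp (θ * Complex.I) * φ (z * Complex.exp (-(θ * Complex.I)))

/-- `h` is the holomorphic branch on `𝔻₋` of the `n`-th root of `φ(z^n)` whose derivative at infinity
is a positive real. On `𝔻₋` there is at most one such branch (and there is one if `φ ∈ Σ'`, `n ≥ 1`). -/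
structure IsKoebeTransform (n : ℕ) (φ h : ℂ → ℂ) : Prop where
  differentiableOn : DifferentiableOn ℂ h extDisk
  pow_eq : ∀ z ∈ extDisk, h z ^ n = φ (z ^ n)
  deriv_infty : ∃ c : ℝ, 0 < c ∧ Tendsto (fun z => h z / z) (Bornology.cobounded ℂ) (𝓝 (c : ℂ))

/-- The Koebe `n`-root transform `(K_n φ)(z) = φ(z^n)^{1/n}`. -/
noncomputable def koebe (n : ℕ) (φ : ℂ → ℂ) : ℂ → ℂ :=
  Classical.epsilon (IsKoebeTransform n φ)

/-- The approximations `f₀ = φ_{θ₀}`, `f_n = f_{n-1} ∘ K_{k^n} φ_{θ_n}` of the snowflake. -/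
noncomputable def approx (φ : ℂ → ℂ) (k : ℕ) (θ : ℕ → ℝ) : ℕ → ℂ → ℂ
  | 0 => rot φ (θ 0)
  | n + 1 => fun z => approx φ k θ n (koebe (k ^ (n + 1)) (rot φ (θ (n + 1))) z)

/-- The conformal snowflake `f = lim f_n` with building block `φ`, integer `k`, rotations `θ`. -/
noncomputable def snowflake (φ : ℂ → ℂ) (k : ℕ) (θ : ℕ → ℝ) (z : ℂ) : ℂ :=
  limUnder atTop (fun n => approx φ k θ n z)

/-- The inverse map `f⁻¹ : f(𝔻₋) → 𝔻₋`; its values off `f(𝔻₋)` are never used. -/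
noncomputable def inv (f : ℂ → ℂ) : ℂ → ℂ := Function.invFunOn f extDisk

/-- With `g = f⁻¹`: the quantity `|g'(w)/g(w)|^τ log^σ |g(w)|` for `w` in the domain `f(𝔻₋)` of `g`,
and `0` for other `w`. -/
noncomputable def density (f : ℂ → ℂ) (τ σ : ℝ) : ℂ → ℝ :=
  (f '' extDisk).indicator fun w => ‖deriv (inv f) w / inv f w‖ ^ τ * Real.log ‖inv f w‖ ^ σ

/-- `F(r) = 𝔼[|g'(r)/g(r)|^τ log^σ |g(r)|]`, as an expectation in `[0, ∞]`, for the snowflake with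
random rotations `θ`. -/
noncomputable def moment {Ω : Type*} [MeasurableSpace Ω] (P : Measure Ω) (φ : ℂ → ℂ) (k : ℕ)
    (θ : ℕ → Ω → ℝ) (τ σ : ℝ) (r : ℝ) : ENNReal :=
  ∫⁻ ω, ENNReal.ofReal (density (snowflake φ k (fun n => θ n ω)) τ σ (r : ℂ)) ∂P

/-- The class `𝓛` of (measurable) functions on `(1, ∞)` that are bounded on compact sets and
integrable in the neighbourhood of `1`. -/
structure IsClassL (F : ℝ → ℝ) : Prop where
  aemeasurable : AEMeasurable F (volume.restrict (Set.Ioi 1))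
  bounded : ∀ K : Set ℝ, IsCompact K → K ⊆ Set.Ioi 1 → ∃ C : ℝ, ∀ r ∈ K, |F r| ≤ C
  integrable : IntegrableAtFilter F (𝓝[>] (1 : ℝ))

/-- With `ψ = φ⁻¹`: the quantity `F(|ψ(w)^k|) |ψ(w)^{k-1} ψ'(w)|^τ` for `w` in the domain `φ(𝔻₋)`
of `ψ`, and `0` for other `w`. -/
noncomputable def pullback (φ : ℂ → ℂ) (k : ℕ) (τ : ℝ) (F : ℝ → ℝ) : ℂ → ℝ :=
  (φ '' extDisk).indicator fun w =>
    F ‖inv φ w ^ k‖ * ‖inv φ w ^ (k - 1) * deriv (inv φ) w‖ ^ τ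

/-- The operator `Qf(r) = k ∫_{-π}^{π} f(|ψ^k(re^{iθ})|) |ψ^{k-1}(re^{iθ}) ψ'(re^{iθ})|^τ dθ/2π`. -/
noncomputable def opQ (φ : ℂ → ℂ) (k : ℕ) (τ : ℝ) (F : ℝ → ℝ) (r : ℝ) : ℝ :=
  k * ∫ s in (-Real.pi)..Real.pi,
    pullback φ k τ F (r * Complex.exp (s * Complex.I)) / (2 * Real.pi)

end Snowflake

namespace Snowflake

open Filter Topology MeasureTheory ProbabilityTheory

/-! The snowflake is self-similar. Write `f` for the limit with rotations `u₀, u₁, …` (`u_j =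
e^{iθ_j}`) and `f̃` for the limit with the shifted rotations `u₁, u₂, …`. Then `f(z) = u₀ φ(u₀⁻¹
H(z))` with `H(z)^k = f̃(z^k)`. Inverting, with `y = ψ(w/u₀)`, gives `g(w)^k = g̃((u₀ y)^k)`. The
logarithmic derivative yields `|g'/g|(w) = |g̃'/g̃|((u₀y)^k) · |y^{k-1} ψ'(w/u₀)|`, and `log|g(w)| =
k⁻¹ log|g̃((u₀y)^k)|` supplies the factor `k^{-σ}`. This pointwise identity is
`density_limitStep_eq`.

The tail is independent of `u₀` and has the law of the whole sequence
(`map_consSeq_prod_infinitePi`). Integrating over the tail first produces the expectation at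
`(u₀y)^k`, which depends only on `|y|^k` because the law is rotation invariant
(`planeMoment_eq_norm`). Integrating over `u₀` then gives the circle integral. Everything is
nonnegative, so Tonelli applies, and finiteness of `F(r)` gives absolute convergence.

The analytic groundwork rests on `φ(z) = z exp ℓ(1/z)` with `Re ℓ ≥ 0`: the Koebe transform of order
`m` never decreases moduli and is `z exp(O(1/m))`, so the compositions converge geometrically to a
univalent limit. -/

/-! ### The exterior of the unit disc. -/

lemma isOpen_extDisk : IsOpen extDisk := isOpen_lt continuous_const continuous_norm

lemma mem_extDisk {z : ℂ} : z ∈ extDisk ↔ 1 < ‖z‖ := Iff.rfl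

lemma eventually_mem_extDisk : ∀ᶠ z in Bornology.cobounded ℂ, z ∈ extDisk :=
  tendsto_norm_cobounded_atTop.eventually_gt_atTop 1

lemma ne_zero_of_mem_extDisk {z : ℂ} (hz : z ∈ extDisk) : z ≠ 0 := by
  rintro rfl
  simp [extDisk] at hz
  linarith

lemma inv_mem_extDisk {ζ : ℂ} (h : ζ ∈ Metric.ball (0 : ℂ) 1) (h0 : ζ ≠ 0) : ζ⁻¹ ∈ extDisk := by
  have := norm_pos_iff.2 h0
  simp only [extDisk, Set.mem_ofPred_eq, norm_inv]
  exact (one_lt_inv₀ this).2 (by simpa using h)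

lemma pow_mem_extDisk {z : ℂ} (hz : z ∈ extDisk) {m : ℕ} (hm : m ≠ 0) : z ^ m ∈ extDisk := by
  simp only [extDisk, Set.mem_ofPred_eq, norm_pow] at *
  exact one_lt_pow₀ hz hm

lemma isPreconnected_extDisk : IsPreconnected extDisk := by
  have : extDisk = Complex.exp '' {z | 0 < z.re} := by
    ext z
    constructor
    · intro hz
      refine ⟨Complex.log z, ?_, Complex.exp_log (ne_zero_of_mem_extDisk hz)⟩
      simpa [Complex.log_re] using Real.log_pos hz
    · rintro ⟨w, hw, rfl⟩
      simpa [extDisk, Complex.norm_exp] using hw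
  rw [this]
  exact (convex_halfSpace_re_gt 0).isPreconnected.image _ Complex.continuous_exp.continuousOn

/-! ### The logarithm of `φ(z)/z`. -/

/-- `ℓ` is the logarithm of `φ(z)/z` in the coordinate `1/z`. -/
structure IsLog (φ ℓ : ℂ → ℂ) : Prop where
  measurable : Measurable ℓ
  differentiableOn : DifferentiableOn ℂ ℓ (Metric.ball 0 1)
  real_zero : ∃ c : ℝ, ℓ 0 = c
  re_nonneg : ∀ ζ ∈ Metric.ball (0 : ℂ) 1, ζ ≠ 0 → 0 ≤ (ℓ ζ).re
  eq_exp : ∀ z ∈ extDisk, φ z = z * Complex.exp (ℓ z⁻¹)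

/-- A nonvanishing holomorphic function on the unit disc with positive value at `0` has a holomorphic
logarithm that is real at `0`. -/
lemma exists_holomorphic_log {G : ℂ → ℂ} (hG : DifferentiableOn ℂ G (Metric.ball 0 1))
    (h0 : ∀ ζ ∈ Metric.ball (0 : ℂ) 1, G ζ ≠ 0) {b : ℝ} (hb : 0 < b) (hGb : G 0 = b) :
    ∃ p : ℂ → ℂ, DifferentiableOn ℂ p (Metric.ball 0 1) ∧ p 0 = (Real.log b : ℝ) ∧
      ∀ ζ ∈ Metric.ball (0 : ℂ) 1, G ζ = Complex.exp (p ζ) := by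
  have hG' : DifferentiableOn ℂ (deriv G) (Metric.ball 0 1) := hG.deriv Metric.isOpen_ball
  obtain ⟨q, hq⟩ := (hG'.div hG h0).isExactOn_ball
  set p : ℂ → ℂ := fun ζ => q ζ - q 0 + (Real.log b : ℝ) with hp
  have hp' : ∀ ζ ∈ Metric.ball (0 : ℂ) 1, HasDerivAt p (deriv G ζ / G ζ) ζ := fun ζ hζ =>
    ((hq ζ hζ).sub_const _).add_const _
  have hmem : (0 : ℂ) ∈ Metric.ball (0 : ℂ) 1 := by simp
  refine ⟨p, fun ζ hζ => (hp' ζ hζ).differentiableAt.differentiableWithinAt, by simp [hp], ?_⟩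
  have hd : ∀ ζ ∈ Metric.ball (0 : ℂ) 1, HasDerivAt (fun x => G x * Complex.exp (-p x)) 0 ζ := by
    intro ζ hζ
    have h1 := ((hG.differentiableAt (Metric.isOpen_ball.mem_nhds hζ)).hasDerivAt).mul
      (hp' ζ hζ).neg.cexp
    refine h1.congr_deriv ?_
    have := h0 ζ hζ
    rw [mul_neg, mul_neg, mul_left_comm, mul_div_cancel₀ _ this, mul_comm, add_neg_cancel]
  intro ζ hζ
  have hc : G ζ * Complex.exp (-p ζ) = G 0 * Complex.exp (-p 0) :=
    Metric.isOpen_ball.is_const_of_deriv_eq_zero (convex_ball (0 : ℂ) 1).isPreconnected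
      (fun x hx => (hd x hx).differentiableAt.differentiableWithinAt)
      (fun x hx => (hd x hx).deriv) hζ hmem
  have h1 : G 0 * Complex.exp (-p 0) = 1 := by
    have : p 0 = (Real.log b : ℝ) := by simp [hp]
    rw [this, hGb, Complex.exp_neg, ← Complex.ofReal_exp, Real.exp_log hb]
    exact mul_inv_cancel₀ (by exact_mod_cast hb.ne')
  rw [h1, Complex.exp_neg] at hc
  field_simp at hc
  exact hc

/-- The function `G(ζ) = ζ φ(1/ζ)` extends over `0` with value `b > 0` and has no zeros, so it has a
logarithm. The sign of the real part is the Schwarz lemma for `ζ/G(ζ) = 1/φ(1/ζ)`, a self-map of the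
disc fixing `0`. -/
lemma IsSigma.exists_isLog {φ : ℂ → ℂ} (hφ : IsSigma φ) : ∃ ℓ, IsLog φ ℓ := by
  obtain ⟨b, hb, hlim⟩ := hφ.deriv_infty
  set G : ℂ → ℂ := Function.update (fun ζ => ζ * φ ζ⁻¹) 0 b with hGdef
  have hmem : Metric.ball (0 : ℂ) 1 ∈ 𝓝 (0 : ℂ) := Metric.ball_mem_nhds _ one_pos
  have hGne : ∀ ζ, ζ ≠ 0 → G ζ = ζ * φ ζ⁻¹ := fun ζ h => Function.update_of_ne h _ _
  have hG0 : G 0 = b := Function.update_self _ _ _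
  have hG : DifferentiableOn ℂ G (Metric.ball 0 1) := by
    refine (Complex.differentiableOn_compl_singleton_and_continuousAt_iff hmem).1 ⟨?_, ?_⟩
    · refine DifferentiableOn.congr (f := fun ζ => ζ * φ ζ⁻¹) ?_ fun ζ hζ => hGne ζ hζ.2
      refine differentiableOn_id.mul (hφ.differentiableOn.comp ?_ ?_)
      · exact fun ζ hζ => (differentiableAt_inv hζ.2).differentiableWithinAt
      · exact fun ζ hζ => inv_mem_extDisk hζ.1 hζ.2
    · rw [hGdef, continuousAt_update_same]
      have := hlim.comp (Filter.tendsto_inv₀_nhdsNE_zero (α := ℂ))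
      refine this.congr fun ζ => ?_
      simp [div_eq_mul_inv, mul_comm]
  have hGz : ∀ ζ ∈ Metric.ball (0 : ℂ) 1, G ζ ≠ 0 := by
    intro ζ hζ
    by_cases h : ζ = 0
    · rw [h, hG0]; exact_mod_cast hb.ne'
    · rw [hGne ζ h]
      exact mul_ne_zero h (ne_zero_of_mem_extDisk (hφ.mapsTo (inv_mem_extDisk hζ h)))
  obtain ⟨p, hp, hp0, hpG⟩ := exists_holomorphic_log hG hGz hb hG0
  -- Cutting off to `0` outside the disc makes the logarithm Borel on all of `ℂ`.
  have hind : ∀ ζ ∈ Metric.ball (0 : ℂ) 1, (Metric.ball (0 : ℂ) 1).indicator p ζ = p ζ :=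
    fun ζ h => Set.indicator_of_mem h _
  refine ⟨(Metric.ball (0 : ℂ) 1).indicator p, ?_, hp.congr hind, ⟨Real.log b, ?_⟩, ?_, ?_⟩
  · classical
    rw [← Set.piecewise_eq_indicator]
    exact hp.continuousOn.measurable_piecewise continuousOn_const measurableSet_ball
  · rw [hind 0 (by simp), hp0]
  · intro ζ hζ h
    rw [hind ζ hζ]
    have h1 : ‖ζ * (G ζ)⁻¹‖ ≤ ‖ζ‖ := by
      refine Complex.norm_le_norm_of_mapsTo_ball (f := fun ζ => ζ * (G ζ)⁻¹) (R := 1)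
        (differentiableOn_id.mul (hG.inv hGz)) ?_ (by simp) (by simpa using hζ)
      intro ξ hξ
      by_cases h : ξ = 0
      · simp [h]
      · have h2 : 1 < ‖φ ξ⁻¹‖ := hφ.mapsTo (inv_mem_extDisk hξ h)
        simp only [hGne ξ h, mul_inv, mul_inv_cancel_left₀ h, Metric.mem_closedBall,
          dist_zero_right, norm_inv]
        exact inv_le_one_of_one_le₀ h2.le
    rw [norm_mul, hpG ζ hζ, norm_inv, Complex.norm_exp] at h1
    have h3 := norm_pos_iff.2 h
    have h4 : (Real.exp (p ζ).re)⁻¹ ≤ 1 := by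
      by_contra! h5
      nlinarith
    rw [← Real.exp_neg, Real.exp_le_one_iff] at h4
    linarith
  · intro z hz
    have hz0 := ne_zero_of_mem_extDisk hz
    have hzi : z⁻¹ ∈ Metric.ball (0 : ℂ) 1 := by
      simpa using inv_lt_one_of_one_lt₀ hz
    rw [hind _ hzi, ← hpG _ hzi, hGne _ (inv_ne_zero hz0), inv_inv, mul_inv_cancel_left₀ hz0]

/-! ### Explicit Koebe transforms and uniqueness of the root branch. -/

/-- The Koebe `m`-root transform of the rotated map `φ_θ`, `v = e^{iθ}`, in terms of the logarithm
`ℓ` of `φ(z)/z`. -/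
noncomputable def koebeStep (ℓ : ℂ → ℂ) (m : ℕ) (v : Circle) (z : ℂ) : ℂ :=
  z * Complex.exp (ℓ (v * (z ^ m)⁻¹) / m)

section

variable {φ ℓ : ℂ → ℂ}

lemma arg_mem_ball {z : ℂ} (hz : z ∈ extDisk) {m : ℕ} (hm : m ≠ 0) (v : Circle) :
    (v : ℂ) * (z ^ m)⁻¹ ∈ Metric.ball (0 : ℂ) 1 := by
  have : 1 < ‖z ^ m‖ := pow_mem_extDisk hz hm
  simpa [Circle.norm_coe] using inv_lt_one_of_one_lt₀ this

lemma arg_ne_zero {z : ℂ} (hz : z ∈ extDisk) (m : ℕ) (v : Circle) :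
    (v : ℂ) * (z ^ m)⁻¹ ≠ 0 :=
  mul_ne_zero v.coe_ne_zero (inv_ne_zero (pow_ne_zero _ (ne_zero_of_mem_extDisk hz)))

lemma norm_le_norm_koebeStep (h : IsLog φ ℓ) {z : ℂ} (hz : z ∈ extDisk) {m : ℕ} (hm : m ≠ 0)
    (v : Circle) : ‖z‖ ≤ ‖koebeStep ℓ m v z‖ := by
  rw [koebeStep, norm_mul, Complex.norm_exp]
  refine le_mul_of_one_le_right (norm_nonneg _) (Real.one_le_exp ?_)
  rw [Complex.div_natCast_re]
  exact div_nonneg (h.re_nonneg _ (arg_mem_ball hz hm v) (arg_ne_zero hz m v)) (Nat.cast_nonneg m)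

lemma koebeStep_mapsTo (h : IsLog φ ℓ) {m : ℕ} (hm : m ≠ 0) (v : Circle) :
    Set.MapsTo (koebeStep ℓ m v) extDisk extDisk :=
  fun _ hz => lt_of_lt_of_le hz (norm_le_norm_koebeStep h hz hm v)

lemma koebeStep_differentiableOn (h : IsLog φ ℓ) {m : ℕ} (hm : m ≠ 0) (v : Circle) :
    DifferentiableOn ℂ (koebeStep ℓ m v) extDisk := by
  refine differentiableOn_id.mul (DifferentiableOn.cexp (DifferentiableOn.div_const ?_ _))
  refine h.differentiableOn.comp ?_ fun z hz => arg_mem_ball hz hm v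
  exact (DifferentiableOn.inv (by fun_prop)
    fun z hz => pow_ne_zero _ (ne_zero_of_mem_extDisk hz)).const_mul _

lemma koebeStep_pow (ℓ : ℂ → ℂ) {m : ℕ} (hm : m ≠ 0) (j : ℕ) (v : Circle) (z : ℂ) :
    koebeStep ℓ (m * j) v z ^ m = koebeStep ℓ j v (z ^ m) := by
  have : (m : ℂ) ≠ 0 := by exact_mod_cast hm
  rw [koebeStep, koebeStep, mul_pow, ← Complex.exp_nat_mul, pow_mul]
  congr 2
  push_cast
  rw [← div_div]
  rw [mul_div_assoc', mul_div_cancel₀ _ this]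

lemma koebeStep_pow_self (ℓ : ℂ → ℂ) {m : ℕ} (hm : m ≠ 0) (v : Circle) (z : ℂ) :
    koebeStep ℓ m v z ^ m = koebeStep ℓ 1 v (z ^ m) := by
  simpa using koebeStep_pow ℓ hm 1 v z

lemma koebeStep_one (h : IsLog φ ℓ) (v : Circle) {z : ℂ} (hz : z ∈ extDisk) :
    koebeStep ℓ 1 v z = v * φ (z * (v : ℂ)⁻¹) := by
  have hv : (v : ℂ) ≠ 0 := v.coe_ne_zero
  have hmem : z * (v : ℂ)⁻¹ ∈ extDisk := by simpa [mem_extDisk, Circle.norm_coe] using hz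
  rw [h.eq_exp _ hmem, koebeStep]
  simp only [pow_one, Nat.cast_one, div_one, mul_inv, inv_inv]
  rw [mul_comm (v : ℂ) z⁻¹]
  field_simp

lemma rot_eq (φ : ℂ → ℂ) (θ : ℝ) (z : ℂ) :
    rot φ θ z = Circle.exp θ * φ (z * (Circle.exp θ : ℂ)⁻¹) := by
  rw [rot, Circle.coe_exp, Complex.exp_neg]

/-- Taking `m`-th powers reduces to injectivity of `φ` and gives `z^m = w^m`. The exponential factor
depends on `z` only through `z^m`, so it cancels. -/
lemma koebeStep_injOn (hφ : IsSigma φ) (h : IsLog φ ℓ) {m : ℕ} (hm : m ≠ 0) (v : Circle) :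
    Set.InjOn (koebeStep ℓ m v) extDisk := by
  intro z hz w hw hzw
  have hv : (v : ℂ) ≠ 0 := v.coe_ne_zero
  have hzm := pow_mem_extDisk hz hm
  have hwm := pow_mem_extDisk hw hm
  have h1 : z ^ m = w ^ m := by
    have h2 := congrArg (· ^ m) hzw
    beta_reduce at h2
    rw [koebeStep_pow_self ℓ hm, koebeStep_pow_self ℓ hm, koebeStep_one h v hzm,
      koebeStep_one h v hwm] at h2
    have h3 := hφ.injOn (by simpa [mem_extDisk, Circle.norm_coe] using hzm)
      (by simpa [mem_extDisk, Circle.norm_coe] using hwm)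
      (mul_left_cancel₀ hv h2)
    exact mul_right_cancel₀ (inv_ne_zero hv) h3
  rw [koebeStep, koebeStep, h1] at hzw
  exact mul_right_cancel₀ (Complex.exp_ne_zero _) hzw

lemma isKoebeTransform_koebeStep (h : IsLog φ ℓ) {m : ℕ} (hm : m ≠ 0) (θ : ℝ) :
    IsKoebeTransform m (rot φ θ) (koebeStep ℓ m (Circle.exp θ)) := by
  refine ⟨koebeStep_differentiableOn h hm _, fun z hz => ?_, ?_⟩
  · rw [koebeStep_pow_self ℓ hm, koebeStep_one h _ (pow_mem_extDisk hz hm), rot_eq]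
  · obtain ⟨c, hc⟩ := h.real_zero
    refine ⟨Real.exp (c / m), Real.exp_pos _, ?_⟩
    have h1 : Tendsto (fun z : ℂ => (Circle.exp θ : ℂ) * (z ^ m)⁻¹) (Bornology.cobounded ℂ)
        (𝓝 0) := by
      have : Tendsto (fun z : ℂ => (z ^ m)⁻¹) (Bornology.cobounded ℂ) (𝓝 0) := by
        have := (Filter.tendsto_inv₀_cobounded (α := ℂ)).pow m
        simpa [hm] using this
      simpa using this.const_mul (Circle.exp θ : ℂ)
    have h2 : ContinuousAt ℓ 0 :=
      (h.differentiableOn.differentiableAt (Metric.ball_mem_nhds _ one_pos)).continuousAt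
    have h3 := ((h2.tendsto.comp h1).div_const (m : ℂ)).cexp
    rw [hc] at h3
    have h4 : (((Real.exp (c / m) : ℝ)) : ℂ) = Complex.exp ((c : ℂ) / m) := by push_cast; rfl
    rw [h4]
    refine h3.congr' ?_
    filter_upwards [eventually_mem_extDisk] with z hz
    rw [koebeStep, mul_div_cancel_left₀ _ (ne_zero_of_mem_extDisk hz)]
    rfl

/-- The quotient of two branches is continuous on a connected set with values in the finite set of
`n`-th roots of unity, hence constant. Its limit at infinity is a positive root of unity, that is,
`1`. -/
lemma IsKoebeTransform.eqOn {n : ℕ} (hn : n ≠ 0) {φ h₁ h₂ : ℂ → ℂ} (H₁ : IsKoebeTransform n φ h₁)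
    (H₂ : IsKoebeTransform n φ h₂) (h0 : ∀ z ∈ extDisk, h₂ z ≠ 0) : Set.EqOn h₁ h₂ extDisk := by
  set q : ℂ → ℂ := fun z => h₁ z / h₂ z with hq
  have hqc : ContinuousOn q extDisk :=
    H₁.differentiableOn.continuousOn.div H₂.differentiableOn.continuousOn h0
  have hqn : ∀ z ∈ extDisk, q z ^ n = 1 := by
    intro z hz
    rw [hq]
    simp only
    rw [div_pow, H₁.pow_eq z hz, ← H₂.pow_eq z hz, div_self (pow_ne_zero _ (h0 z hz))]
  have hfin : {x : ℂ | x ^ n = 1}.Finite := by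
    have : {x : ℂ | x ^ n = 1} = (Polynomial.nthRootsFinset n (1 : ℂ) : Set ℂ) := by
      ext x; simp [Polynomial.mem_nthRootsFinset (Nat.pos_of_ne_zero hn)]
    rw [this]
    exact Finset.finite_toSet _
  have hsub : (q '' extDisk).Subsingleton :=
    hfin.countable.isTotallyDisconnected _ (by rintro _ ⟨z, hz, rfl⟩; exact hqn z hz)
      (isPreconnected_extDisk.image q hqc)
  obtain ⟨c₁, hc₁, L₁⟩ := H₁.deriv_infty
  obtain ⟨c₂, hc₂, L₂⟩ := H₂.deriv_infty
  have hlim : Tendsto q (Bornology.cobounded ℂ) (𝓝 ((c₁ / c₂ : ℝ) : ℂ)) := by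
    push_cast
    refine (L₁.div L₂ (by exact_mod_cast hc₂.ne')).congr' ?_
    filter_upwards [eventually_mem_extDisk] with z hz
    have := ne_zero_of_mem_extDisk hz
    simp only [Pi.div_apply, hq]
    rw [div_div_div_cancel_right₀ this]
  have hpow : (c₁ / c₂) ^ n = 1 := by
    have h1 : Tendsto (fun z => q z ^ n) (Bornology.cobounded ℂ) (𝓝 1) :=
      tendsto_const_nhds.congr' (by filter_upwards [eventually_mem_extDisk] with z hz using (hqn z hz).symm)
    have := tendsto_nhds_unique (hlim.pow n) h1
    exact_mod_cast this
  have hone : c₁ / c₂ = 1 := (pow_eq_one_iff_of_nonneg (by positivity) hn).1 hpow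
  rw [hone] at hlim
  intro z hz
  have h2 : Tendsto q (Bornology.cobounded ℂ) (𝓝 (q z)) :=
    tendsto_const_nhds.congr' (by
      filter_upwards [eventually_mem_extDisk] with w hw
      exact hsub ⟨z, hz, rfl⟩ ⟨w, hw, rfl⟩)
  have h3 : q z = 1 := by simpa using tendsto_nhds_unique h2 hlim
  exact (div_eq_one_iff_eq (h0 z hz)).1 h3

lemma koebe_eqOn (h : IsLog φ ℓ) {m : ℕ} (hm : m ≠ 0) (θ : ℝ) :
    Set.EqOn (koebe m (rot φ θ)) (koebeStep ℓ m (Circle.exp θ)) extDisk :=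
  have H := isKoebeTransform_koebeStep h hm θ
  (Classical.epsilon_spec (p := IsKoebeTransform m (rot φ θ)) ⟨_, H⟩).eqOn hm H
    fun _ hz => ne_zero_of_mem_extDisk (koebeStep_mapsTo h hm _ hz)

end

/-! ### Compositions of Koebe transforms and their limit. -/

/-- The composition of the Koebe transforms of orders `m, mk, …, mk^(n-1)`, with rotations `u`. -/
noncomputable def iterStep (ℓ : ℂ → ℂ) (k : ℕ) : ℕ → ℕ → (ℕ → Circle) → ℂ → ℂ
  | 0, _, _, z => z
  | n + 1, m, u, z => koebeStep ℓ m (u 0) (iterStep ℓ k n (m * k) (fun i => u (i + 1)) z)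

/-- The infinite composition of the Koebe transforms of orders `m, mk, mk², …`, with rotations `u`. -/
noncomputable def limitStep (ℓ : ℂ → ℂ) (k m : ℕ) (u : ℕ → Circle) (z : ℂ) : ℂ :=
  limUnder atTop (fun n => iterStep ℓ k n m u z)

/-- The definition peels off the outermost factor; convergence and comparison with `approx` need the
innermost one, which is the factor added at each stage. -/
lemma iterStep_succ' (ℓ : ℂ → ℂ) (k n m : ℕ) (u : ℕ → Circle) (z : ℂ) :
    iterStep ℓ k (n + 1) m u z = iterStep ℓ k n m u (koebeStep ℓ (m * k ^ n) (u n) z) := by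
  induction n generalizing m u with
  | zero => simp [iterStep]
  | succ n ih => rw [iterStep, ih, iterStep, pow_succ', mul_assoc]

section

variable {φ ℓ : ℂ → ℂ} {k : ℕ}

lemma norm_le_norm_iterStep (h : IsLog φ ℓ) (hk : k ≠ 0) (n : ℕ) {m : ℕ} (hm : m ≠ 0)
    (u : ℕ → Circle) {z : ℂ} (hz : z ∈ extDisk) : ‖z‖ ≤ ‖iterStep ℓ k n m u z‖ := by
  induction n generalizing m u with
  | zero => simp [iterStep]
  | succ n ih =>
    have h1 := ih (mul_ne_zero hm hk) (fun i => u (i + 1))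
    exact h1.trans (norm_le_norm_koebeStep h (lt_of_lt_of_le hz h1) hm _)

lemma iterStep_mapsTo (h : IsLog φ ℓ) (hk : k ≠ 0) (n : ℕ) {m : ℕ} (hm : m ≠ 0)
    (u : ℕ → Circle) : Set.MapsTo (iterStep ℓ k n m u) extDisk extDisk :=
  fun _ hz => lt_of_lt_of_le hz (norm_le_norm_iterStep h hk n hm u hz)

lemma iterStep_differentiableOn (h : IsLog φ ℓ) (hk : k ≠ 0) (n : ℕ) {m : ℕ} (hm : m ≠ 0)
    (u : ℕ → Circle) : DifferentiableOn ℂ (iterStep ℓ k n m u) extDisk := by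
  induction n generalizing m u with
  | zero => exact differentiableOn_id
  | succ n ih =>
    exact (koebeStep_differentiableOn h hm (u 0)).comp (ih (mul_ne_zero hm hk) _)
      (iterStep_mapsTo h hk n (mul_ne_zero hm hk) _)

lemma iterStep_pow (ℓ : ℂ → ℂ) (k n : ℕ) {m : ℕ} (hm : m ≠ 0) (j : ℕ) (u : ℕ → Circle) (z : ℂ) :
    iterStep ℓ k n (m * j) u z ^ m = iterStep ℓ k n j u (z ^ m) := by
  induction n generalizing j u with
  | zero => rfl
  | succ n ih => rw [iterStep, iterStep, koebeStep_pow ℓ hm, mul_assoc, ih]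

lemma koebeStep_mul (ℓ : ℂ → ℂ) (m : ℕ) (u v : Circle) (z : ℂ) :
    koebeStep ℓ m u (v * z) = v * koebeStep ℓ m (u * (v ^ m)⁻¹) z := by
  rw [koebeStep, koebeStep, mul_assoc]
  push_cast
  rw [mul_pow, mul_inv, mul_assoc (u : ℂ)]

/-- A rotation `v` passes out of each step unchanged, altering the rotation of a step of order `m`
by `v^{-m}`; the `j`-th factor has order `m * k ^ j`. -/
lemma iterStep_mul (ℓ : ℂ → ℂ) (k n m : ℕ) (u : ℕ → Circle) (v : Circle) (z : ℂ) :
    iterStep ℓ k n m u (v * z) =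
      v * iterStep ℓ k n m (fun j => u j * (v ^ (m * k ^ j))⁻¹) z := by
  induction n generalizing m u with
  | zero => rfl
  | succ n ih =>
    rw [iterStep, ih, koebeStep_mul, iterStep]
    simp only [pow_zero, mul_one, pow_succ', mul_assoc]

lemma exists_norm_log_le (h : IsLog φ ℓ) {R : ℝ} (hR : 1 < R) :
    ∃ A : ℝ, 0 ≤ A ∧ ∀ ζ : ℂ, ‖ζ‖ ≤ R⁻¹ → ‖ℓ ζ‖ ≤ A := by
  have hsub : Metric.closedBall (0 : ℂ) R⁻¹ ⊆ Metric.ball 0 1 :=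
    Metric.closedBall_subset_ball (inv_lt_one_of_one_lt₀ hR)
  obtain ⟨A, hA⟩ := (isCompact_closedBall (0 : ℂ) R⁻¹).exists_bound_of_continuousOn
    (h.differentiableOn.continuousOn.mono hsub)
  refine ⟨A, (norm_nonneg _).trans (hA 0 (by simp; linarith)), fun ζ hζ => hA ζ (by simpa using hζ)⟩

/-- Moduli never decrease, so the step of order `m k^j` contributes an exponent of size at most
`A/(m k^j)`. Since `k ≥ 2`, the geometric sum is at most `2A/m`. -/
lemma exists_iterStep_eq (h : IsLog φ ℓ) (hk : 2 ≤ k) {R A : ℝ} (hR : 1 < R)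
    (hA : 0 ≤ A ∧ ∀ ζ : ℂ, ‖ζ‖ ≤ R⁻¹ → ‖ℓ ζ‖ ≤ A) (n : ℕ) {m : ℕ} (hm : m ≠ 0)
    (u : ℕ → Circle) {z : ℂ} (hz : R ≤ ‖z‖) :
    ∃ a : ℂ, ‖a‖ ≤ 2 * A / m ∧ iterStep ℓ k n m u z = z * Complex.exp a := by
  have hk0 : k ≠ 0 := by omega
  induction n generalizing m u with
  | zero =>
    have := hA.1
    exact ⟨0, by simp; positivity, by simp [iterStep]⟩
  | succ n ih =>
    obtain ⟨a, ha, hae⟩ := ih (mul_ne_zero hm hk0) (fun i => u (i + 1))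
    set w := iterStep ℓ k n (m * k) (fun i => u (i + 1)) z with hw
    have hzw : R ≤ ‖w‖ :=
      hz.trans (norm_le_norm_iterStep h hk0 n (mul_ne_zero hm hk0) _ (hR.trans_le hz))
    have hm0 : (0 : ℝ) < m := by positivity
    refine ⟨a + ℓ (u 0 * (w ^ m)⁻¹) / m, ?_, ?_⟩
    · have h1 : ‖ℓ (u 0 * (w ^ m)⁻¹)‖ ≤ A := by
        refine hA.2 _ ?_
        rw [norm_mul, Circle.norm_coe, one_mul, norm_inv, norm_pow]
        refine inv_anti₀ (by linarith) (hzw.trans ?_)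
        exact le_self_pow₀ (hR.le.trans hzw) hm
      calc _ ≤ ‖a‖ + ‖ℓ (u 0 * (w ^ m)⁻¹) / m‖ := norm_add_le _ _
        _ ≤ A / m + A / m := by
          refine add_le_add (ha.trans ?_) ?_
          · push_cast
            have : (2 : ℝ) ≤ k := by exact_mod_cast hk
            rw [div_le_div_iff₀ (by positivity) hm0]
            nlinarith [mul_nonneg hA.1 hm0.le]
          · rw [norm_div, Complex.norm_natCast]
            gcongr
        _ = 2 * A / m := by ring
    · rw [iterStep, ← hw, koebeStep, Complex.exp_add, ← mul_assoc, ← hae]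

lemma norm_iterStep_le (h : IsLog φ ℓ) (hk : 2 ≤ k) {R A : ℝ} (hR : 1 < R)
    (hA : 0 ≤ A ∧ ∀ ζ : ℂ, ‖ζ‖ ≤ R⁻¹ → ‖ℓ ζ‖ ≤ A) (n : ℕ) {m : ℕ} (hm : m ≠ 0)
    (u : ℕ → Circle) {z : ℂ} (hz : R ≤ ‖z‖) :
    ‖iterStep ℓ k n m u z‖ ≤ Real.exp (2 * A) * ‖z‖ := by
  obtain ⟨a, ha, hae⟩ := exists_iterStep_eq h hk hR hA n hm u hz
  have hm1 : (1 : ℝ) ≤ m := by exact_mod_cast Nat.one_le_iff_ne_zero.2 hm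
  rw [hae, norm_mul, mul_comm]
  gcongr
  refine (Complex.norm_exp_le_exp_norm a).trans (Real.exp_le_exp.2 (ha.trans ?_))
  exact div_le_self (by linarith [hA.1]) hm1

lemma norm_iterStep_sub_le (h : IsLog φ ℓ) (hk : 2 ≤ k) {R A : ℝ} (hR : 1 < R)
    (hA : 0 ≤ A ∧ ∀ ζ : ℂ, ‖ζ‖ ≤ R⁻¹ → ‖ℓ ζ‖ ≤ A) (n : ℕ) {m : ℕ} (hm : m ≠ 0)
    (u : ℕ → Circle) {z : ℂ} (hz : R ≤ ‖z‖) :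
    ‖iterStep ℓ k n m u z - z‖ ≤ ‖z‖ * (2 * A * Real.exp (2 * A)) / m := by
  obtain ⟨a, ha, hae⟩ := exists_iterStep_eq h hk hR hA n hm u hz
  have hm1 : (1 : ℝ) ≤ m := by exact_mod_cast Nat.one_le_iff_ne_zero.2 hm
  have h1 : ‖Complex.exp a - 1‖ ≤ ‖a‖ * Real.exp ‖a‖ := by
    simpa using Complex.norm_exp_sub_sum_le_norm_mul_exp a 1
  have h2 : Real.exp ‖a‖ ≤ Real.exp (2 * A) :=
    Real.exp_le_exp.2 (ha.trans (div_le_self (by linarith [hA.1]) hm1))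
  calc _ = ‖z‖ * ‖Complex.exp a - 1‖ := by rw [hae, ← norm_mul, mul_sub, mul_one]
    _ ≤ ‖z‖ * (2 * A / m * Real.exp (2 * A)) := by
      gcongr
      exact h1.trans (mul_le_mul ha h2 (Real.exp_pos _).le ((norm_nonneg _).trans ha))
    _ = _ := by ring

/-- Consecutive iterates are one map evaluated at `z` and at `w`, the image of `z` under a step of
order `m k^n`, so `w` is `O(2⁻ⁿ)` from `z`. The Schwarz lemma on a ball makes that map Lipschitz
with a constant independent of `n`, `m` and `u`. -/
lemma exists_dist_iterStep_le (h : IsLog φ ℓ) (hk : 2 ≤ k) {R : ℝ} (hR : 1 < R) (R' : ℝ) :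
    ∃ C : ℝ, ∀ z : ℂ, R ≤ ‖z‖ → ‖z‖ ≤ R' → ∀ m : ℕ, m ≠ 0 → ∀ (u : ℕ → Circle) (n : ℕ),
      dist (iterStep ℓ k n m u z) (iterStep ℓ k (n + 1) m u z) ≤ C * (1 / 2) ^ n := by
  have hk0 : k ≠ 0 := by omega
  -- With this radius `R - r = 1 + r`, so balls of radius `r` around points with `‖z‖ ≥ R` stay away
  -- from the unit circle.
  set r := (R - 1) / 2 with hr
  have hr0 : 0 < r := by rw [hr]; linarith
  have hR0 : 1 < 1 + r := by linarith
  obtain ⟨A, hA⟩ := exists_norm_log_le h hR0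
  set B := Real.exp (2 * A) with hB
  have hB1 : 1 ≤ B := Real.one_le_exp (by linarith [hA.1])
  -- The first factor is a bound for the distance between image points, divided by the radius; the
  -- second bounds `2ⁿ · dist w z`.
  refine ⟨(B * (B * R' + r + R')) / r * (R' * (2 * A * B)), fun z hz hz' m hm u n => ?_⟩
  have hR'0 : 0 < R' := by linarith
  have hzr : 1 + r ≤ ‖z‖ := by linarith
  have hmk : m * k ^ n ≠ 0 := mul_ne_zero hm (pow_ne_zero _ hk0)
  rw [iterStep_succ']
  set w := koebeStep ℓ (m * k ^ n) (u n) z with hw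
  have hw1 : w = iterStep ℓ k 1 (m * k ^ n) (fun _ => u n) z := by simp [iterStep, hw]
  have hwz : 1 + r ≤ ‖w‖ :=
    hzr.trans (norm_le_norm_koebeStep h (hR0.trans_le hzr) hmk _)
  have hwn : ‖w‖ ≤ B * ‖z‖ := hw1 ▸ norm_iterStep_le h hk hR0 hA 1 hmk _ hzr
  have hwd : dist w z ≤ (R' * (2 * A * B)) * (1 / 2) ^ n := by
    have h1 := norm_iterStep_sub_le h hk hR0 hA 1 hmk (fun _ => u n) hzr
    rw [← hw1, ← dist_eq_norm] at h1
    refine h1.trans ?_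
    have h2 : (2 : ℝ) ^ n ≤ (m * k ^ n : ℕ) := by
      have h3 : 2 ^ n ≤ m * k ^ n :=
        (Nat.pow_le_pow_left hk n).trans (Nat.le_mul_of_pos_left _ (Nat.pos_of_ne_zero hm))
      exact_mod_cast h3
    have := hA.1
    rw [one_div, inv_pow, ← div_eq_mul_inv]
    gcongr
  have key : dist (iterStep ℓ k n m u w) (iterStep ℓ k n m u z) ≤
      (B * (B * R' + r + R')) / r * dist w z := by
    have hbd : ∀ x : ℂ, 1 + r ≤ ‖x‖ → ‖x‖ ≤ B * R' + r →
        dist (iterStep ℓ k n m u x) (iterStep ℓ k n m u z) ≤ B * (B * R' + r + R') := by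
      intro x hx hx'
      calc _ ≤ ‖iterStep ℓ k n m u x‖ + ‖iterStep ℓ k n m u z‖ := dist_le_norm_add_norm _ _
        _ ≤ B * ‖x‖ + B * ‖z‖ := add_le_add (norm_iterStep_le h hk hR0 hA n hm u hx)
            (norm_iterStep_le h hk hR0 hA n hm u hzr)
        _ ≤ B * (B * R' + r) + B * R' := by gcongr
        _ = _ := by ring
    have hball : ∀ x ∈ Metric.ball z r, 1 + r ≤ ‖x‖ ∧ ‖x‖ ≤ B * R' + r := by
      intro x hx
      rw [Metric.mem_ball, dist_eq_norm] at hx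
      have h1 := norm_sub_norm_le z x
      have h2 := norm_sub_norm_le x z
      rw [norm_sub_rev] at h1
      constructor
      · linarith
      · nlinarith
    by_cases hwr : w ∈ Metric.ball z r
    · refine Complex.dist_le_div_mul_dist_of_mapsTo_ball
        ((iterStep_differentiableOn h hk0 n hm u).mono fun x hx => hR0.trans_le (hball x hx).1)
        (fun x hx => ?_) hwr
      exact hbd x (hball x hx).1 (hball x hx).2
    · rw [Metric.mem_ball, not_lt] at hwr
      refine (hbd w hwz (by nlinarith)).trans ?_
      rw [div_mul_eq_mul_div, le_div_iff₀ hr0]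
      gcongr
  rw [dist_comm]
  refine key.trans ?_
  rw [mul_assoc]
  gcongr

lemma tendsto_iterStep (h : IsLog φ ℓ) (hk : 2 ≤ k) {m : ℕ} (hm : m ≠ 0) (u : ℕ → Circle) {z : ℂ}
    (hz : z ∈ extDisk) :
    Tendsto (fun n => iterStep ℓ k n m u z) atTop (𝓝 (limitStep ℓ k m u z)) := by
  obtain ⟨C, hC⟩ := exists_dist_iterStep_le h hk hz ‖z‖
  exact (cauchySeq_of_le_geometric (1 / 2) C (by norm_num)
    (hC z le_rfl le_rfl m hm u)).tendsto_limUnder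

lemma limitStep_differentiableOn (h : IsLog φ ℓ) (hk : 2 ≤ k) {m : ℕ} (hm : m ≠ 0)
    (u : ℕ → Circle) : DifferentiableOn ℂ (limitStep ℓ k m u) extDisk := by
  have hk0 : k ≠ 0 := by omega
  refine TendstoLocallyUniformlyOn.differentiableOn (F := fun n => iterStep ℓ k n m u)
    (φ := atTop) ?_ (Eventually.of_forall fun n => iterStep_differentiableOn h hk0 n hm u)
    isOpen_extDisk
  rw [Metric.tendstoLocallyUniformlyOn_iff]
  intro ε hε z hz
  have hz1 : 1 < ‖z‖ := hz
  obtain ⟨C, hC⟩ := exists_dist_iterStep_le h hk (show 1 < (1 + ‖z‖) / 2 by linarith) (‖z‖ + 1)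
  refine ⟨{x | (1 + ‖z‖) / 2 < ‖x‖ ∧ ‖x‖ < ‖z‖ + 1}, mem_nhdsWithin_of_mem_nhds ?_, ?_⟩
  · exact ((isOpen_lt continuous_const continuous_norm).inter
      (isOpen_lt continuous_norm continuous_const)).mem_nhds
        ⟨show (1 + ‖z‖) / 2 < ‖z‖ by linarith, show ‖z‖ < ‖z‖ + 1 by linarith⟩
  · have h1 : Tendsto (fun n : ℕ => C * (1 / 2 : ℝ) ^ n / (1 - 1 / 2)) atTop (𝓝 0) := by
      have := ((tendsto_pow_atTop_nhds_zero_of_lt_one (r := (1 / 2 : ℝ)) (by norm_num)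
        (by norm_num)).const_mul C).div_const (1 - 1 / 2)
      simpa using this
    filter_upwards [h1.eventually_lt_const hε] with n hn x hx
    have hx1 : x ∈ extDisk := lt_trans (by linarith) hx.1
    rw [dist_comm]
    exact (dist_le_of_le_geometric_of_tendsto (1 / 2) C (by norm_num)
      (hC x hx.1.le hx.2.le m hm u) (tendsto_iterStep h hk hm u hx1) n).trans_lt hn

lemma norm_le_norm_limitStep (h : IsLog φ ℓ) (hk : 2 ≤ k) {m : ℕ} (hm : m ≠ 0) (u : ℕ → Circle)
    {z : ℂ} (hz : z ∈ extDisk) : ‖z‖ ≤ ‖limitStep ℓ k m u z‖ :=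
  ge_of_tendsto' (tendsto_iterStep h hk hm u hz).norm
    fun n => norm_le_norm_iterStep h (by omega) n hm u hz

lemma limitStep_mapsTo (h : IsLog φ ℓ) (hk : 2 ≤ k) {m : ℕ} (hm : m ≠ 0) (u : ℕ → Circle) :
    Set.MapsTo (limitStep ℓ k m u) extDisk extDisk :=
  fun _ hz => lt_of_lt_of_le hz (norm_le_norm_limitStep h hk hm u hz)

lemma limitStep_eq_koebeStep (h : IsLog φ ℓ) (hk : 2 ≤ k) {m : ℕ} (hm : m ≠ 0) (u : ℕ → Circle)
    {z : ℂ} (hz : z ∈ extDisk) : limitStep ℓ k m u z =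
      koebeStep ℓ m (u 0) (limitStep ℓ k (m * k) (fun i => u (i + 1)) z) := by
  have hmk : m * k ≠ 0 := mul_ne_zero hm (by omega)
  have h1 := tendsto_iterStep h hk hmk (fun i => u (i + 1)) hz
  have h2 := ((koebeStep_differentiableOn h hm (u 0)).differentiableAt
    (isOpen_extDisk.mem_nhds (limitStep_mapsTo h hk hmk (fun i => u (i + 1)) hz))).continuousAt
  exact tendsto_nhds_unique ((tendsto_add_atTop_iff_nat 1).2 (tendsto_iterStep h hk hm u hz))
    (h2.tendsto.comp h1)

lemma limitStep_pow (h : IsLog φ ℓ) (hk : 2 ≤ k) {m : ℕ} (hm : m ≠ 0) (u : ℕ → Circle)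
    {z : ℂ} (hz : z ∈ extDisk) : limitStep ℓ k m u z ^ m = limitStep ℓ k 1 u (z ^ m) := by
  refine tendsto_nhds_unique ((tendsto_iterStep h hk hm u hz).pow m) ?_
  refine (tendsto_iterStep h hk one_ne_zero u (pow_mem_extDisk hz hm)).congr fun n => ?_
  simpa using (iterStep_pow ℓ k n hm 1 u z).symm

lemma limitStep_mul (h : IsLog φ ℓ) (hk : 2 ≤ k) {m : ℕ} (hm : m ≠ 0) (u : ℕ → Circle)
    (v : Circle) {z : ℂ} (hz : z ∈ extDisk) : limitStep ℓ k m u (v * z) =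
      v * limitStep ℓ k m (fun j => u j * (v ^ (m * k ^ j))⁻¹) z := by
  have hvz : (v : ℂ) * z ∈ extDisk := by simpa [mem_extDisk, Circle.norm_coe] using hz
  refine tendsto_nhds_unique (tendsto_iterStep h hk hm u hvz) ?_
  refine ((tendsto_iterStep h hk hm _ hz).const_mul _).congr fun n => ?_
  exact (iterStep_mul ℓ k n m u v z).symm

lemma tendsto_limitStep (h : IsLog φ ℓ) (hk : 2 ≤ k) {m : ℕ → ℕ} (hm : ∀ n, m n ≠ 0)
    (hlim : Tendsto m atTop atTop) (u : ℕ → ℕ → Circle) {z : ℂ} (hz : z ∈ extDisk) :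
    Tendsto (fun n => limitStep ℓ k (m n) (u n) z) atTop (𝓝 z) := by
  obtain ⟨A, hA⟩ := exists_norm_log_le h hz
  rw [tendsto_iff_norm_sub_tendsto_zero]
  refine squeeze_zero (g := fun n => ‖z‖ * (2 * A * Real.exp (2 * A)) / m n)
    (fun _ => norm_nonneg _) (fun n => ?_) ?_
  · exact le_of_tendsto' ((tendsto_iterStep h hk (hm n) (u n) hz).sub_const z).norm
      fun j => norm_iterStep_sub_le h hk hz hA j (hm n) (u n) le_rfl
  · exact (tendsto_const_nhds.div_atTop (tendsto_natCast_atTop_atTop.comp hlim))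

/-- Each step is injective, so an equality of values descends to every tail of the composition. The
orders of the tails tend to infinity, so the tails converge to the identity and the two points
coincide. -/
lemma limitStep_injOn (hφ : IsSigma φ) (h : IsLog φ ℓ) (hk : 2 ≤ k) {m : ℕ} (hm : m ≠ 0)
    (u : ℕ → Circle) : Set.InjOn (limitStep ℓ k m u) extDisk := by
  intro z hz w hw hzw
  have hk0 : k ≠ 0 := by omega
  have hmn : ∀ n, m * k ^ n ≠ 0 := fun n => mul_ne_zero hm (pow_ne_zero _ hk0)
  have hn : ∀ n, limitStep ℓ k (m * k ^ n) (fun i => u (i + n)) z =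
      limitStep ℓ k (m * k ^ n) (fun i => u (i + n)) w := by
    intro n
    induction n with
    | zero => simpa using hzw
    | succ n ih =>
      rw [limitStep_eq_koebeStep h hk (hmn n) _ hz, limitStep_eq_koebeStep h hk (hmn n) _ hw] at ih
      have := koebeStep_injOn hφ h (hmn n) _
        (limitStep_mapsTo h hk (mul_ne_zero (hmn n) hk0) _ hz)
        (limitStep_mapsTo h hk (mul_ne_zero (hmn n) hk0) _ hw) ih
      simpa only [pow_succ, mul_assoc, add_assoc, add_comm 1 n] using this
  have hlim : Tendsto (fun n => m * k ^ n) atTop atTop :=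
    (tendsto_pow_atTop_atTop_of_one_lt (by omega)).const_mul_atTop' (Nat.pos_of_ne_zero hm)
  have h1 := tendsto_limitStep h hk hmn hlim (fun n i => u (i + n)) hz
  have h2 := tendsto_limitStep h hk hmn hlim (fun n i => u (i + n)) hw
  simp only [hn] at h1
  exact tendsto_nhds_unique h1 h2

/-- The index shifts by one because `f₀` already contains a factor, the step of order `1`. -/
lemma approx_eqOn (h : IsLog φ ℓ) (hk : 2 ≤ k) (θ : ℕ → ℝ) (n : ℕ) :
    Set.EqOn (approx φ k θ n) (iterStep ℓ k (n + 1) 1 (fun i => Circle.exp (θ i))) extDisk := by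
  induction n with
  | zero =>
    intro z hz
    simp only [approx, iterStep]
    rw [rot_eq, koebeStep_one h _ hz]
  | succ n ih =>
    intro z hz
    have hkn : k ^ (n + 1) ≠ 0 := pow_ne_zero _ (by omega)
    rw [iterStep_succ', one_mul, ← koebe_eqOn h hkn _ hz]
    refine ih ?_
    rw [koebe_eqOn h hkn _ hz]
    exact koebeStep_mapsTo h hkn _ hz

lemma snowflake_eqOn (h : IsLog φ ℓ) (hk : 2 ≤ k) (θ : ℕ → ℝ) :
    Set.EqOn (snowflake φ k θ) (limitStep ℓ k 1 (fun i => Circle.exp (θ i))) extDisk := by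
  intro z hz
  refine Tendsto.limUnder_eq ?_
  refine ((tendsto_add_atTop_iff_nat 1).2 (tendsto_iterStep h hk one_ne_zero _ hz)).congr ?_
  exact fun n => (approx_eqOn h hk θ n hz).symm

end

/-! ### The density of a univalent map. -/

noncomputable instance : MeasurableSpace Circle := borel Circle

instance : BorelSpace Circle := ⟨rfl⟩

section density

variable {f f' : ℂ → ℂ} {z w : ℂ}

lemma inv_apply (hinj : Set.InjOn f extDisk) (hz : z ∈ extDisk) : inv f (f z) = z :=
  hinj.leftInvOn_invFunOn hz

/-- The derivative of the inverse of an injective holomorphic function; if `f'` vanishes at `z`, then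
the inverse is not differentiable at `f z`, and both sides are `0`. -/
lemma deriv_inv_apply (hd : DifferentiableOn ℂ f extDisk) (hinj : Set.InjOn f extDisk)
    (hz : z ∈ extDisk) : deriv (inv f) (f z) = (deriv f z)⁻¹ := by
  have hev : ∀ᶠ x in 𝓝 z, inv f (f x) = x := by
    filter_upwards [isOpen_extDisk.mem_nhds hz] with x hx using inv_apply hinj hx
  have hfz := (hd.analyticAt (isOpen_extDisk.mem_nhds hz))
  by_cases h0 : deriv f z = 0
  · rw [h0, inv_zero]
    refine deriv_zero_of_not_differentiableAt fun hg => ?_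
    have h1 := hg.hasDerivAt.comp z hfz.differentiableAt.hasDerivAt
    rw [h0, mul_zero] at h1
    exact zero_ne_one (h1.unique ((hasDerivAt_id z).congr_of_eventuallyEq hev))
  · exact (hfz.hasStrictDerivAt.to_local_left_inverse h0 hev).hasDerivAt.deriv

lemma density_apply (hd : DifferentiableOn ℂ f extDisk) (hinj : Set.InjOn f extDisk) (τ σ : ℝ)
    (hz : z ∈ extDisk) :
    density f τ σ (f z) = ‖(deriv f z)⁻¹ / z‖ ^ τ * Real.log ‖z‖ ^ σ := by
  rw [density, Set.indicator_of_mem (Set.mem_image_of_mem f hz), deriv_inv_apply hd hinj hz,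
    inv_apply hinj hz]

lemma density_of_notMem (τ σ : ℝ) (hw : w ∉ f '' extDisk) : density f τ σ w = 0 :=
  Set.indicator_of_notMem hw _

lemma density_congr (h : Set.EqOn f f' extDisk) (hd : DifferentiableOn ℂ f' extDisk)
    (hinj : Set.InjOn f' extDisk) (τ σ : ℝ) : density f τ σ = density f' τ σ := by
  ext w
  by_cases hw : w ∈ f '' extDisk
  · obtain ⟨z, hz, rfl⟩ := hw
    rw [density_apply (hd.congr h) (hinj.congr h.symm) τ σ hz, h hz, density_apply hd hinj τ σ hz,
      (h.eventuallyEq_of_mem (isOpen_extDisk.mem_nhds hz)).deriv_eq]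
  · rw [density_of_notMem τ σ hw, density_of_notMem τ σ (h.image_eq ▸ hw)]

end density

/-! ### Joint measurability in the rotations and the point. -/

section measurable

variable {φ ℓ : ℂ → ℂ} {k : ℕ}

lemma measurable_koebeStep (h : IsLog φ ℓ) (m : ℕ) :
    Measurable fun p : Circle × ℂ => koebeStep ℓ m p.1 p.2 := by
  have h1 : Measurable fun p : Circle × ℂ => ((p.1 : ℂ)) := by fun_prop
  have h2 := h.measurable
  unfold koebeStep
  fun_prop

lemma measurable_iterStep (h : IsLog φ ℓ) (k n m : ℕ) :
    Measurable fun p : (ℕ → Circle) × ℂ => iterStep ℓ k n m p.1 p.2 := by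
  induction n generalizing m with
  | zero => exact measurable_snd
  | succ n ih =>
    have h1 : Measurable fun p : (ℕ → Circle) × ℂ =>
        ((fun i => p.1 (i + 1) : ℕ → Circle), p.2) := by fun_prop
    have h2 : Measurable fun p : (ℕ → Circle) × ℂ => p.1 0 := by fun_prop
    exact (measurable_koebeStep h m).comp (h2.prodMk ((ih (m * k)).comp h1))

lemma measurable_limitStep (h : IsLog φ ℓ) (k m : ℕ) :
    Measurable fun p : (ℕ → Circle) × ℂ => limitStep ℓ k m p.1 p.2 :=
  (StronglyMeasurable.limUnder fun n => (measurable_iterStep h k n m).stronglyMeasurable).measurable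

/-- The derivative of a jointly measurable family of functions, holomorphic on an open set `s`, is
jointly measurable on `s`. -/
lemma measurable_deriv_of_differentiableOn {X : Type*} [MeasurableSpace X] {f : X → ℂ → ℂ}
    (hf : Measurable fun p : X × ℂ => f p.1 p.2) {s : Set ℂ} (hs : IsOpen s)
    (hd : ∀ x, DifferentiableOn ℂ (f x) s) :
    Measurable fun p : X × s => deriv (f p.1) p.2 := by
  -- Difference quotients along `1/(n+1)`; shifted points outside `s` are harmless, since `f` is
  -- measurable everywhere.
  have hlim : Tendsto (fun n : ℕ => ((1 / ((n : ℝ) + 1) : ℝ) : ℂ)) atTop (𝓝[≠] 0) := by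
    refine tendsto_nhdsWithin_iff.2 ⟨?_, Eventually.of_forall fun n => ?_⟩
    · exact (Complex.continuous_ofReal.tendsto 0).comp
        (tendsto_one_div_add_atTop_nhds_zero_nat (𝕜 := ℝ))
    · have : (1 / ((n : ℝ) + 1)) ≠ 0 := by positivity
      exact Complex.ofReal_ne_zero.2 this
  refine measurable_of_tendsto_metrizable
    (f := fun (n : ℕ) (p : X × s) => ((1 / ((n : ℝ) + 1) : ℝ) : ℂ)⁻¹ *
      (f p.1 (p.2 + ((1 / ((n : ℝ) + 1) : ℝ) : ℂ)) - f p.1 p.2)) (fun n => ?_) ?_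
  · have h1 : Measurable fun p : X × s => (p.1, (p.2 : ℂ) + ((1 / ((n : ℝ) + 1) : ℝ) : ℂ)) := by
      fun_prop
    have h2 : Measurable fun p : X × s => (p.1, (p.2 : ℂ)) := by fun_prop
    exact ((hf.comp h1).sub (hf.comp h2)).const_mul _
  · refine tendsto_pi_nhds.2 fun p => ?_
    have := ((hd p.1).differentiableAt (hs.mem_nhds p.2.2)).hasDerivAt
    exact (hasDerivAt_iff_tendsto_slope_zero.1 this).comp hlim

/-- By the Lusin–Souslin theorem the injective Borel map `(u, z) ↦ (u, f_u(z))` is a measurable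
embedding. The density is the extension by `0` along it of a function measurable in `(u, z)`. -/
lemma measurable_density (hφ : IsSigma φ) (h : IsLog φ ℓ) (hk : 2 ≤ k) {m : ℕ} (hm : m ≠ 0)
    (τ σ : ℝ) :
    Measurable fun p : (ℕ → Circle) × ℂ => density (limitStep ℓ k m p.1) τ σ p.2 := by
  have hd := fun u => limitStep_differentiableOn h hk hm u
  have hinj := fun u => limitStep_injOn hφ h hk hm u
  have hms : MeasurableSet extDisk := isOpen_extDisk.measurableSet
  have : StandardBorelSpace extDisk := hms.standardBorel
  have h2 : Measurable fun p : (ℕ → Circle) × extDisk => (p.1, (p.2 : ℂ)) := by fun_prop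
  set Φ : (ℕ → Circle) × extDisk → (ℕ → Circle) × ℂ := fun p => (p.1, limitStep ℓ k m p.1 p.2)
    with hΦ
  have hΦm : Measurable Φ := measurable_fst.prodMk ((measurable_limitStep h k m).comp h2)
  have hΦi : Function.Injective Φ := by
    rintro ⟨u, z⟩ ⟨u', z'⟩ hp
    simp only [hΦ, Prod.mk.injEq] at hp
    obtain ⟨rfl, hp⟩ := hp
    rw [Subtype.ext (hinj u z.2 z'.2 hp)]
  have hemb := hΦm.measurableEmbedding hΦi
  set d : (ℕ → Circle) × extDisk → ℝ := fun p =>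
    ‖(deriv (limitStep ℓ k m p.1) p.2)⁻¹ / p.2‖ ^ τ * Real.log ‖(p.2 : ℂ)‖ ^ σ with hdd
  have hdm : Measurable d := by
    have := measurable_deriv_of_differentiableOn (measurable_limitStep h k m) isOpen_extDisk hd
    fun_prop
  convert hemb.measurable_extend hdm (measurable_const (a := (0 : ℝ))) using 1
  ext ⟨u, w⟩
  by_cases hw : w ∈ limitStep ℓ k m u '' extDisk
  · obtain ⟨z, hz, rfl⟩ := hw
    have h3 := hΦi.extend_apply d (fun _ => 0) (u, ⟨z, hz⟩)
    simp only [hΦ, hdd] at h3 ⊢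
    rw [h3]
    exact density_apply (hd u) (hinj u) τ σ hz
  · rw [Function.extend_apply']
    · exact density_of_notMem τ σ hw
    · rintro ⟨⟨u', z⟩, hp⟩
      simp only [hΦ, Prod.mk.injEq] at hp
      obtain ⟨rfl, hp⟩ := hp
      exact hw ⟨z, z.2, hp⟩

end measurable

/-! ### Rotation and self-similarity of the density. -/

section factor

variable {φ ℓ : ℂ → ℂ} {k : ℕ}

lemma density_limitStep_mul (hφ : IsSigma φ) (h : IsLog φ ℓ) (hk : 2 ≤ k) (τ σ : ℝ)
    (u : ℕ → Circle) (v : Circle) (w : ℂ) :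
    density (limitStep ℓ k 1 u) τ σ (v * w) =
      density (limitStep ℓ k 1 (fun j => u j * (v ^ (k ^ j))⁻¹)) τ σ w := by
  set u' : ℕ → Circle := fun j => u j * (v ^ (k ^ j))⁻¹ with hu'
  have hv : (v : ℂ) ≠ 0 := v.coe_ne_zero
  have hmul : ∀ z ∈ extDisk, limitStep ℓ k 1 u (v * z) = v * limitStep ℓ k 1 u' z := by
    intro z hz
    simpa using limitStep_mul h hk one_ne_zero u v hz
  have hmem : ∀ {v : Circle} {z}, z ∈ extDisk → (v : ℂ) * z ∈ extDisk := by
    intro v z hz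
    simpa [mem_extDisk, Circle.norm_coe] using hz
  have hd := fun u => limitStep_differentiableOn h hk one_ne_zero u
  have hinj := fun u => limitStep_injOn hφ h hk one_ne_zero u
  by_cases hw : w ∈ limitStep ℓ k 1 u' '' extDisk
  · obtain ⟨z, hz, rfl⟩ := hw
    have hdv : deriv (limitStep ℓ k 1 u) (v * z) = deriv (limitStep ℓ k 1 u') z := by
      have h1 := (((hd u).differentiableAt
        (isOpen_extDisk.mem_nhds (hmem hz))).hasDerivAt.comp z ((hasDerivAt_id z).const_mul (v : ℂ)))
      have h2 := (((hd u').differentiableAt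
        (isOpen_extDisk.mem_nhds hz)).hasDerivAt.const_mul (v : ℂ))
      have h3 := h1.unique (h2.congr_of_eventuallyEq (by
        filter_upwards [isOpen_extDisk.mem_nhds hz] with x hx using hmul x hx))
      rw [mul_one, mul_comm] at h3
      exact mul_left_cancel₀ hv h3
    rw [← hmul z hz, density_apply (hd u) (hinj u) τ σ (hmem hz),
      density_apply (hd u') (hinj u') τ σ hz, hdv]
    simp [Circle.norm_coe]
  · rw [density_of_notMem τ σ hw, density_of_notMem]
    rintro ⟨z, hz, hzw⟩
    have hz' : (v : ℂ)⁻¹ * z ∈ extDisk := by simpa using hmem (v := v⁻¹) hz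
    refine hw ⟨(v : ℂ)⁻¹ * z, hz', mul_left_cancel₀ hv ?_⟩
    rw [← hmul _ hz', mul_inv_cancel_left₀ hv, hzw]

lemma limitStep_one_eq (h : IsLog φ ℓ) (hk : 2 ≤ k) (u : ℕ → Circle) {z : ℂ} (hz : z ∈ extDisk) :
    limitStep ℓ k 1 u z =
      u 0 * φ (limitStep ℓ k k (fun i => u (i + 1)) z * (u 0 : ℂ)⁻¹) := by
  rw [limitStep_eq_koebeStep h hk one_ne_zero u hz, one_mul,
    koebeStep_one h _ (limitStep_mapsTo h hk (by omega) _ hz)]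

/-- If `a^k` is a value of the limit map of order `1`, then `a` is a value of the limit map of
order `k`. -/
lemma exists_limitStep_eq (h : IsLog φ ℓ) (hk : 2 ≤ k) (u : ℕ → Circle) {a x : ℂ} (ha : a ≠ 0)
    (hx : x ∈ extDisk) (hax : limitStep ℓ k 1 u x = a ^ k) :
    ∃ z ∈ extDisk, z ^ k = x ∧ limitStep ℓ k k u z = a := by
  have hk0 : k ≠ 0 := by omega
  obtain ⟨z, rfl⟩ := IsAlgClosed.exists_pow_nat_eq x (Nat.pos_of_ne_zero hk0)
  have hz : z ∈ extDisk := by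
    rw [mem_extDisk, norm_pow] at hx
    exact (one_lt_pow_iff_of_nonneg (norm_nonneg z) hk0).1 hx
  have hH0 := ne_zero_of_mem_extDisk (limitStep_mapsTo h hk hk0 u hz)
  rw [← limitStep_pow h hk hk0 u hz] at hax
  have hζ : (a / limitStep ℓ k k u z) ^ k = 1 := by
    rw [div_pow, hax, div_self (pow_ne_zero _ ha)]
  have hζ1 : ‖a / limitStep ℓ k k u z‖ = 1 :=
    (pow_eq_one_iff_of_nonneg (norm_nonneg _) hk0).1 (by rw [← norm_pow, hζ, norm_one])
  obtain ⟨ζ, hζc⟩ : ∃ ζ : Circle, (ζ : ℂ) = a / limitStep ℓ k k u z :=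
    ⟨⟨_, by simpa [Submonoid.unitSphere] using hζ1⟩, rfl⟩
  have hζk : ζ ^ k = 1 := by
    apply Circle.ext
    push_cast
    rw [hζc, hζ]
  refine ⟨ζ * z, by simpa [mem_extDisk, Circle.norm_coe] using hz, ?_, ?_⟩
  · rw [mul_pow, hζc, hζ, one_mul]
  · rw [limitStep_mul h hk hk0 u ζ hz]
    -- The exponents `k * k ^ j` are multiples of `k`, so the root of unity `ζ` leaves all the
    -- rotations unchanged.
    simp only [pow_mul, hζk, one_pow, inv_one, mul_one]
    rw [hζc, div_mul_cancel₀ _ hH0]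

/-- This is `g(w)^k = g̃((u₀ y)^k)` with `y = ψ(w/u₀)`, differentiated logarithmically. The zero
conventions match: `w` is a value of `f` exactly when `w/u₀` is a value of `φ` and `(u₀ y)^k` is a
value of `f̃`. -/
lemma density_limitStep_eq (hφ : IsSigma φ) (h : IsLog φ ℓ) (hk : 2 ≤ k) (τ σ : ℝ)
    (u : ℕ → Circle) (w : ℂ) :
    density (limitStep ℓ k 1 u) τ σ w =
      (k : ℝ) ^ (-σ) * (φ '' extDisk).indicator (fun x =>
        density (limitStep ℓ k 1 (fun i => u (i + 1))) τ σ ((u 0 : ℂ) ^ k * inv φ x ^ k) *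
          ‖inv φ x ^ (k - 1) * deriv (inv φ) x‖ ^ τ) (w * (u 0 : ℂ)⁻¹) := by
  have hk0 : k ≠ 0 := by omega
  set v := u 0 with hv_def
  set u' : ℕ → Circle := fun i => u (i + 1) with hu'
  have hv : (v : ℂ) ≠ 0 := v.coe_ne_zero
  have hf : ∀ {z}, z ∈ extDisk → limitStep ℓ k 1 u z = v * φ (limitStep ℓ k k u' z * (v : ℂ)⁻¹) :=
    fun hz => limitStep_one_eq h hk u hz
  have hmem : ∀ {z}, z ∈ extDisk → limitStep ℓ k k u' z * (v : ℂ)⁻¹ ∈ extDisk := by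
    intro z hz
    have := limitStep_mapsTo h hk hk0 u' hz
    simpa [mem_extDisk, Circle.norm_coe] using this
  have hd := fun u => limitStep_differentiableOn h hk one_ne_zero u
  have hinj := fun u => limitStep_injOn hφ h hk one_ne_zero u
  by_cases hw : w * (v : ℂ)⁻¹ ∈ φ '' extDisk
  · rw [Set.indicator_of_mem hw]
    obtain ⟨y, hy, hyw⟩ := hw
    rw [← hyw, inv_apply hφ.injOn hy, deriv_inv_apply hφ.differentiableOn hφ.injOn hy, ← mul_pow]
    have hy0 := ne_zero_of_mem_extDisk hy
    have hwv : w = v * φ y := by rw [hyw]; field_simp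
    by_cases hx : ((v : ℂ) * y) ^ k ∈ limitStep ℓ k 1 u' '' extDisk
    · obtain ⟨x, hx, hxy⟩ := hx
      obtain ⟨z, hz, rfl, hzy⟩ := exists_limitStep_eq h hk u' (mul_ne_zero hv hy0) hx hxy
      have hz0 := ne_zero_of_mem_extDisk hz
      have hzv : limitStep ℓ k k u' z * (v : ℂ)⁻¹ = y := by rw [hzy]; field_simp
      have hfz : limitStep ℓ k 1 u z = w := by
        rw [hf hz, hzv, hwv]
      have hH := ((limitStep_differentiableOn h hk hk0 u').differentiableAt
        (isOpen_extDisk.mem_nhds hz)).hasDerivAt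
      have hφy : HasDerivAt φ (deriv φ y) (limitStep ℓ k k u' z * (v : ℂ)⁻¹) := by
        rw [hzv]
        exact (hφ.differentiableOn.differentiableAt (isOpen_extDisk.mem_nhds hy)).hasDerivAt
      have hd1 : deriv (limitStep ℓ k 1 u) z = deriv φ y * deriv (limitStep ℓ k k u') z := by
        have h1 := ((hφy.comp z (hH.mul_const (v : ℂ)⁻¹)).const_mul (v : ℂ))
        have h2 := h1.congr_of_eventuallyEq (f₁ := limitStep ℓ k 1 u) (by
          filter_upwards [isOpen_extDisk.mem_nhds hz] with x hx using hf hx)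
        rw [h2.deriv]
        field_simp
      -- Differentiating `H(z)^k = f̃(z^k)` at a point with `H(z) = v y`.
      have hd2 : (k : ℂ) * (v * y) ^ (k - 1) * deriv (limitStep ℓ k k u') z =
          deriv (limitStep ℓ k 1 u') (z ^ k) * (k * z ^ (k - 1)) := by
        have h1 := hH.pow k
        have h2 := ((hd u').differentiableAt (isOpen_extDisk.mem_nhds hx)).hasDerivAt.comp z
          (hasDerivAt_pow k z)
        have h3 := h1.unique (h2.congr_of_eventuallyEq (by
          filter_upwards [isOpen_extDisk.mem_nhds hz] with x hx using limitStep_pow h hk hk0 u' hx))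
        rw [hzy] at h3
        exact h3
      have hkC : (k : ℂ) ≠ 0 := by exact_mod_cast hk0
      have hvy := pow_ne_zero (k - 1) (mul_ne_zero hv hy0)
      have hd3 : deriv (limitStep ℓ k k u') z =
          deriv (limitStep ℓ k 1 u') (z ^ k) * z ^ (k - 1) / (v * y) ^ (k - 1) := by
        rw [eq_div_iff hvy]
        apply mul_left_cancel₀ hkC
        linear_combination hd2
      have hnorm : ‖(deriv (limitStep ℓ k 1 u) z)⁻¹ / z‖ =
          ‖(deriv (limitStep ℓ k 1 u') (z ^ k))⁻¹ / z ^ k‖ * ‖y ^ (k - 1) * (deriv φ y)⁻¹‖ := by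
        rw [hd1, hd3]
        simp only [norm_mul, norm_div, norm_inv, norm_pow, Circle.norm_coe, one_mul, mul_inv,
          inv_div]
        have h4 : ‖z‖ ^ k = ‖z‖ ^ (k - 1) * ‖z‖ := by
          rw [← pow_succ, Nat.sub_add_cancel (by omega)]
        rw [h4]
        simp only [div_eq_mul_inv, mul_inv]
        ring
      have hlog : Real.log ‖z ^ k‖ = k * Real.log ‖z‖ := by rw [norm_pow, Real.log_pow]
      have hkR : (0 : ℝ) < k := by positivity
      rw [← hfz, density_apply (hd u) (hinj u) τ σ hz, ← hxy,
        density_apply (hd u') (hinj u') τ σ hx, hnorm, hlog,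
        Real.mul_rpow (norm_nonneg _) (norm_nonneg _),
        Real.mul_rpow hkR.le (Real.log_pos hz).le, Real.rpow_neg hkR.le]
      have := Real.rpow_pos_of_pos hkR σ
      field_simp
    · rw [density_of_notMem τ σ hx, density_of_notMem, zero_mul, mul_zero]
      rintro ⟨z, hz, hzw⟩
      rw [hf hz, hwv] at hzw
      have h1 := hφ.injOn (hmem hz) hy (mul_left_cancel₀ hv hzw)
      refine hx ⟨z ^ k, pow_mem_extDisk hz hk0, ?_⟩
      rw [← limitStep_pow h hk hk0 u' hz, ← h1]
      field_simp
  · rw [Set.indicator_of_notMem hw, mul_zero]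
    refine density_of_notMem τ σ ?_
    rintro ⟨z, hz, rfl⟩
    refine hw ⟨_, hmem hz, ?_⟩
    rw [hf hz]
    field_simp

end factor

/-! ### Uniform rotations and the product law. -/

/-- The law of `e^{iθ}` for `θ` uniformly distributed on `[-π, π]`. -/
noncomputable def circleLaw : Measure Circle :=
  (volume[|Set.Icc (-Real.pi) Real.pi]).map Circle.exp

lemma measurable_circleExp : Measurable (Circle.exp : ℝ → Circle) := Circle.exp.continuous.measurable

lemma volume_cond_Icc : (volume : Measure ℝ)[|Set.Icc (-Real.pi) Real.pi] =
    (ENNReal.ofReal (2 * Real.pi))⁻¹ • volume.restrict (Set.Ioc (-Real.pi) Real.pi) := by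
  rw [ProbabilityTheory.cond, Real.volume_Icc, Measure.restrict_congr_set Ioc_ae_eq_Icc]
  congr 3
  ring

instance : IsProbabilityMeasure (volume[|Set.Icc (-Real.pi) Real.pi] : Measure ℝ) := by
  have := Real.pi_pos
  refine cond_isProbabilityMeasure_of_finite ?_ ?_
  · rw [Real.volume_Icc]
    exact (ENNReal.ofReal_pos.2 (by linarith)).ne'
  · rw [Real.volume_Icc]
    exact ENNReal.ofReal_ne_top

instance : IsProbabilityMeasure circleLaw :=
  Measure.isProbabilityMeasure_map measurable_circleExp.aemeasurable

/-- Up to normalisation the law is the image of Lebesgue measure on `ℝ/2πℤ`, where multiplication by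
`v` becomes a translation. -/
lemma circleLaw_map_mul_right (v : Circle) : circleLaw.map (· * v) = circleLaw := by
  have : Fact (0 < 2 * Real.pi) := ⟨Real.two_pi_pos⟩
  have h0 : (volume.restrict (Set.Ioc (-Real.pi) Real.pi)).map Circle.exp =
      (volume : Measure (AddCircle (2 * Real.pi))).map AddCircle.homeomorphCircle' := by
    have h1 := AddCircle.measurePreserving_mk (2 * Real.pi) (-Real.pi)
    rw [show -Real.pi + 2 * Real.pi = Real.pi by ring] at h1
    rw [← h1.map_eq, Measure.map_map AddCircle.homeomorphCircle'.continuous.measurable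
      h1.measurable]
    congr 1
  have h2 : circleLaw = (ENNReal.ofReal (2 * Real.pi))⁻¹ •
      (volume : Measure (AddCircle (2 * Real.pi))).map AddCircle.homeomorphCircle' := by
    rw [circleLaw, volume_cond_Icc, Measure.map_smul, h0]
  obtain ⟨a, rfl⟩ := AddCircle.homeomorphCircle'.surjective v
  have hm : Measurable (AddCircle.homeomorphCircle' : AddCircle (2 * Real.pi) → Circle) :=
    AddCircle.homeomorphCircle'.continuous.measurable
  have h3 : (fun x => x * AddCircle.homeomorphCircle' a) ∘ AddCircle.homeomorphCircle' =
      AddCircle.homeomorphCircle' ∘ (· + a) := by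
    ext x
    induction x using QuotientAddGroup.induction_on
    induction a using QuotientAddGroup.induction_on
    rw [Function.comp_apply, Function.comp_apply, ← QuotientAddGroup.mk_add]
    simp only [AddCircle.homeomorphCircle'_apply_mk, Circle.exp_add]
  rw [h2, Measure.map_smul, Measure.map_map (by fun_prop) hm, h3,
    ← Measure.map_map hm (by fun_prop), map_add_right_eq_self]

/-- The sequence with first term `v` and tail `u`. -/
def consSeq {α : Type*} (v : α) (u : ℕ → α) : ℕ → α
  | 0 => v
  | n + 1 => u n

lemma measurable_consSeq {α : Type*} [MeasurableSpace α] :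
    Measurable fun p : α × (ℕ → α) => consSeq p.1 p.2 := by
  refine measurable_pi_iff.2 fun n => ?_
  cases n with
  | zero => exact measurable_fst
  | succ n => exact (measurable_pi_apply n).comp measurable_snd

/-- The product measure is determined by finite boxes. Padding a box with `Set.univ` makes its index
set an initial segment, and the box then splits into its first side and a box in the tail. -/
lemma map_consSeq_prod_infinitePi {α : Type*} [MeasurableSpace α] (ν : Measure α)
    [IsProbabilityMeasure ν] :
    (ν.prod (Measure.infinitePi fun _ : ℕ => ν)).map (fun p => consSeq p.1 p.2) =
      Measure.infinitePi fun _ : ℕ => ν := by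
  classical
  refine Measure.eq_infinitePi _ fun s t ht => ?_
  obtain ⟨N, hN⟩ : ∃ N, s ⊆ Finset.range (N + 1) := by
    obtain ⟨N, hN⟩ := s.exists_nat_subset_range
    exact ⟨N, hN.trans (Finset.range_mono (Nat.le_succ N))⟩
  set t' : ℕ → Set α := fun i => if i ∈ s then t i else Set.univ with ht'
  have htm : ∀ i, MeasurableSet (t' i) := fun i => by
    by_cases hi : i ∈ s <;> simp [ht', hi, ht i]
  have h1 : (s : Set ℕ).pi t = ((Finset.range (N + 1) : Finset ℕ) : Set ℕ).pi t' := by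
    ext x
    simp only [Set.mem_pi, Finset.mem_coe]
    refine ⟨fun h i _ => ?_, fun h i hi => ?_⟩
    · by_cases hi : i ∈ s
      · simpa [ht', hi] using h i hi
      · simp [ht', hi]
    · simpa [ht', hi] using h i (hN hi)
  have h2 : ∏ i ∈ s, ν (t i) = ∏ i ∈ Finset.range (N + 1), ν (t' i) := by
    rw [← Finset.prod_subset hN (f := fun i => ν (t' i)) fun i _ hi => by simp [ht', hi]]
    exact Finset.prod_congr rfl fun i hi => by simp [ht', hi]
  have h3 : (fun p : α × (ℕ → α) => consSeq p.1 p.2) ⁻¹'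
      ((Finset.range (N + 1) : Finset ℕ) : Set ℕ).pi t' =
      t' 0 ×ˢ ((Finset.range N : Finset ℕ) : Set ℕ).pi (fun i => t' (i + 1)) := by
    ext ⟨v, u⟩
    simp only [Set.mem_preimage, Set.mem_pi, Finset.mem_coe, Finset.mem_range, Set.mem_prod]
    refine ⟨fun h => ⟨h 0 (Nat.succ_pos N), fun i hi => h (i + 1) (by omega)⟩, fun h i hi => ?_⟩
    cases i with
    | zero => exact h.1
    | succ i => exact h.2 i (by omega)
  rw [h2, h1, Measure.map_apply measurable_consSeq
    (MeasurableSet.pi (Finset.countable_toSet _) fun i _ => htm i), h3, Measure.prod_prod,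
    Measure.infinitePi_pi _ fun i _ => htm (i + 1), Finset.prod_range_succ', mul_comm]

/-! ### Expectations and the integral equation. -/

section moment

variable {φ ℓ : ℂ → ℂ} {k : ℕ}

/-- The expectation of the density of the snowflake at a point `w` of the plane. -/
noncomputable def planeMoment (ℓ : ℂ → ℂ) (k : ℕ) (τ σ : ℝ) (w : ℂ) : ENNReal :=
  ∫⁻ u, ENNReal.ofReal (density (limitStep ℓ k 1 u) τ σ w)
    ∂(Measure.infinitePi fun _ : ℕ => circleLaw)

lemma measurable_ofReal_density (hφ : IsSigma φ) (h : IsLog φ ℓ) (hk : 2 ≤ k) (τ σ : ℝ) (w : ℂ) :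
    Measurable fun u : ℕ → Circle => ENNReal.ofReal (density (limitStep ℓ k 1 u) τ σ w) :=
  ((measurable_density hφ h hk one_ne_zero τ σ).comp
    (measurable_id.prodMk measurable_const)).ennreal_ofReal

lemma moment_eq_planeMoment {Ω : Type*} [MeasurableSpace Ω] (P : Measure Ω)
    [IsProbabilityMeasure P] (hφ : IsSigma φ) (h : IsLog φ ℓ) (hk : 2 ≤ k)
    (θ : ℕ → Ω → ℝ) (hmeas : ∀ n, Measurable (θ n)) (hindep : iIndepFun θ P)
    (hunif : ∀ n, pdf.IsUniform (θ n) (Set.Icc (-Real.pi) Real.pi) P volume)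
    (τ σ r : ℝ) : moment P φ k θ τ σ r = planeMoment ℓ k τ σ r := by
  have hm : ∀ n, Measurable fun ω => Circle.exp (θ n ω) :=
    fun n => measurable_circleExp.comp (hmeas n)
  have hlaw : P.map (fun ω n => Circle.exp (θ n ω)) =
      Measure.infinitePi fun _ : ℕ => circleLaw := by
    have h1 : iIndepFun (fun n ω => Circle.exp (θ n ω)) P :=
      hindep.comp (fun _ => Circle.exp) fun _ => measurable_circleExp
    rw [h1.map_fun_eq_infinitePi_map hm]
    congr 1
    ext1 n
    rw [circleLaw, ← show P.map (θ n) = _ from hunif n,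
      Measure.map_map measurable_circleExp (hmeas n)]
    rfl
  rw [planeMoment, ← hlaw, lintegral_map (measurable_ofReal_density hφ h hk τ σ r)
    (measurable_pi_iff.2 hm), moment]
  refine lintegral_congr fun ω => ?_
  rw [density_congr (snowflake_eqOn h hk _) (limitStep_differentiableOn h hk one_ne_zero _)
    (limitStep_injOn hφ h hk one_ne_zero _)]

/-- Rotating the point amounts to multiplying each `u_j` by a fixed element of the circle, which
preserves the product law. -/
lemma planeMoment_mul (hφ : IsSigma φ) (h : IsLog φ ℓ) (hk : 2 ≤ k) (τ σ : ℝ) (v : Circle)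
    (w : ℂ) : planeMoment ℓ k τ σ (v * w) = planeMoment ℓ k τ σ w := by
  have hinv : (Measure.infinitePi fun _ : ℕ => circleLaw).map
      (fun u j => u j * (v ^ (k ^ j))⁻¹) = Measure.infinitePi fun _ : ℕ => circleLaw := by
    rw [Measure.infinitePi_map_pi (f := fun j x => x * (v ^ (k ^ j))⁻¹) _
      fun j => measurable_mul_const _]
    simp only [circleLaw_map_mul_right]
  conv_rhs => rw [planeMoment, ← hinv]
  rw [lintegral_map (measurable_ofReal_density hφ h hk τ σ w) (by fun_prop), planeMoment]
  exact lintegral_congr fun u => by rw [density_limitStep_mul hφ h hk]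

lemma planeMoment_eq_norm (hφ : IsSigma φ) (h : IsLog φ ℓ) (hk : 2 ≤ k) (τ σ : ℝ) (w : ℂ) :
    planeMoment ℓ k τ σ w = planeMoment ℓ k τ σ (‖w‖ : ℝ) := by
  rw [← planeMoment_mul hφ h hk τ σ (Circle.exp w.arg) (‖w‖ : ℝ), Circle.coe_exp, mul_comm,
    Complex.norm_mul_exp_arg_mul_I]

/-- With the first rotation frozen, only the tail is random. Its expectation at `(v y)^k` is
`F(|y^k|)` by rotation invariance. -/
lemma lintegral_density_consSeq (hφ : IsSigma φ) (h : IsLog φ ℓ) (hk : 2 ≤ k) (τ σ : ℝ)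
    {F : ℝ → ℝ} (hF : ∀ r : ℝ, 1 < r → planeMoment ℓ k τ σ r = ENNReal.ofReal (F r) ∧ 0 ≤ F r)
    (v : Circle) (w : ℂ) :
    ∫⁻ u, ENNReal.ofReal (density (limitStep ℓ k 1 (consSeq v u)) τ σ w)
        ∂(Measure.infinitePi fun _ : ℕ => circleLaw) =
      ENNReal.ofReal ((k : ℝ) ^ (-σ) * pullback φ k τ F (w * (v : ℂ)⁻¹)) := by
  have hkσ : 0 ≤ (k : ℝ) ^ (-σ) := by positivity
  simp only [density_limitStep_eq hφ h hk τ σ (consSeq v _) w]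
  simp only [consSeq, pullback]
  by_cases hw : w * (v : ℂ)⁻¹ ∈ φ '' extDisk
  · simp only [Set.indicator_of_mem hw]
    set y := inv φ (w * (v : ℂ)⁻¹) with hy
    set c := ‖y ^ (k - 1) * deriv (inv φ) (w * (v : ℂ)⁻¹)‖ ^ τ with hc
    have hc0 : 0 ≤ c := by positivity
    have hyk : 1 < ‖y ^ k‖ := by
      obtain ⟨x, hx, hxw⟩ := hw
      rw [hy, ← hxw, inv_apply hφ.injOn hx]
      exact pow_mem_extDisk hx (by omega)
    have h1 : ∀ x : ℝ, ENNReal.ofReal ((k : ℝ) ^ (-σ) * (x * c)) =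
        ENNReal.ofReal ((k : ℝ) ^ (-σ) * c) * ENNReal.ofReal x := by
      intro x
      rw [← ENNReal.ofReal_mul (by positivity)]
      ring_nf
    have h2 := planeMoment_eq_norm hφ h hk τ σ ((v : ℂ) ^ k * y ^ k)
    rw [norm_mul, norm_pow (v : ℂ), Circle.norm_coe, one_pow, one_mul, (hF _ hyk).1] at h2
    simp only [h1]
    rw [lintegral_const_mul _ (measurable_ofReal_density hφ h hk τ σ _), ← h2]
    rfl
  · simp [Set.indicator_of_notMem hw]

lemma pullback_nonneg (hφ : IsSigma φ) (hk : k ≠ 0) (τ : ℝ) {F : ℝ → ℝ}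
    (hF : ∀ r : ℝ, 1 < r → 0 ≤ F r) (w : ℂ) : 0 ≤ pullback φ k τ F w := by
  refine Set.indicator_nonneg ?_ _
  rintro _ ⟨x, hx, rfl⟩
  rw [inv_apply hφ.injOn hx]
  exact mul_nonneg (hF _ (pow_mem_extDisk hx hk)) (by positivity)

/-- Measurability is read off from the probabilistic side: up to a positive constant the function is
a partial integral of a jointly measurable one. -/
lemma measurable_pullback_circle (hφ : IsSigma φ) (h : IsLog φ ℓ) (hk : 2 ≤ k) (τ σ : ℝ)
    {F : ℝ → ℝ} (hF : ∀ r : ℝ, 1 < r → planeMoment ℓ k τ σ r = ENNReal.ofReal (F r) ∧ 0 ≤ F r)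
    (w : ℂ) : Measurable fun v : Circle => pullback φ k τ F (w * (v : ℂ)⁻¹) := by
  have hk0 : (0 : ℝ) < k := by exact_mod_cast (show 0 < k by omega)
  have hkσ := Real.rpow_pos_of_pos hk0 (-σ)
  have h0 := fun v : Circle => pullback_nonneg hφ (by omega) τ (fun r hr => (hF r hr).2)
    (w * (v : ℂ)⁻¹) (k := k)
  have h1 : Measurable fun v : Circle =>
      ENNReal.ofReal ((k : ℝ) ^ (-σ) * pullback φ k τ F (w * (v : ℂ)⁻¹)) := by
    simp only [← lintegral_density_consSeq hφ h hk τ σ hF]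
    refine Measurable.lintegral_prod_right' (f := fun p : Circle × (ℕ → Circle) =>
      ENNReal.ofReal (density (limitStep ℓ k 1 (consSeq p.1 p.2)) τ σ w)) ?_
    exact (measurable_ofReal_density hφ h hk τ σ w).comp measurable_consSeq
  convert h1.ennreal_toReal.const_mul ((k : ℝ) ^ (-σ))⁻¹ using 1
  ext v
  rw [ENNReal.toReal_ofReal (mul_nonneg hkσ.le (h0 v)), inv_mul_cancel_left₀ hkσ.ne']

lemma lintegral_pullback_circle (hφ : IsSigma φ) (h : IsLog φ ℓ) (hk : 2 ≤ k) (τ σ : ℝ)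
    {F : ℝ → ℝ} (hF : ∀ r : ℝ, 1 < r → planeMoment ℓ k τ σ r = ENNReal.ofReal (F r) ∧ 0 ≤ F r)
    (w : ℂ) : ∫⁻ v, ENNReal.ofReal ((k : ℝ) ^ (-σ) * pullback φ k τ F (w * (v : ℂ)⁻¹)) ∂circleLaw =
      planeMoment ℓ k τ σ w := by
  have hm := measurable_ofReal_density hφ h hk τ σ w
  have hm' : Measurable fun p : Circle × (ℕ → Circle) =>
      ENNReal.ofReal (density (limitStep ℓ k 1 (consSeq p.1 p.2)) τ σ w) :=
    hm.comp measurable_consSeq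
  rw [planeMoment, ← map_consSeq_prod_infinitePi, lintegral_map hm measurable_consSeq,
    lintegral_prod _ hm'.aemeasurable]
  exact lintegral_congr fun v => (lintegral_density_consSeq hφ h hk τ σ hF v w).symm

lemma integrable_integral_pullback (hφ : IsSigma φ) (h : IsLog φ ℓ) (hk : 2 ≤ k) (τ σ : ℝ)
    {F : ℝ → ℝ} (hF : ∀ r : ℝ, 1 < r → planeMoment ℓ k τ σ r = ENNReal.ofReal (F r) ∧ 0 ≤ F r)
    {r : ℝ} (hr : 1 < r) :
    Integrable (fun v : Circle => pullback φ k τ F (r * (v : ℂ)⁻¹)) circleLaw ∧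
      (k : ℝ) ^ (-σ) * ∫ v, pullback φ k τ F (r * (v : ℂ)⁻¹) ∂circleLaw = F r := by
  have hk0 : (0 : ℝ) < k := by exact_mod_cast (show 0 < k by omega)
  have hkσ := Real.rpow_pos_of_pos hk0 (-σ)
  have h0 : ∀ v : Circle, 0 ≤ (k : ℝ) ^ (-σ) * pullback φ k τ F (r * (v : ℂ)⁻¹) := fun v =>
    mul_nonneg hkσ.le (pullback_nonneg hφ (by omega) τ (fun r hr => (hF r hr).2) _)
  have hm := (measurable_pullback_circle hφ h hk τ σ hF r).const_mul ((k : ℝ) ^ (-σ))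
  have hl := lintegral_pullback_circle hφ h hk τ σ hF r
  rw [(hF r hr).1] at hl
  constructor
  · have hi : Integrable (fun v : Circle => (k : ℝ) ^ (-σ) * pullback φ k τ F (r * (v : ℂ)⁻¹))
        circleLaw := by
      refine ⟨hm.aestronglyMeasurable, ?_⟩
      rw [hasFiniteIntegral_iff_ofReal (Eventually.of_forall h0), hl]
      exact ENNReal.ofReal_lt_top
    exact (integrable_const_mul_iff (IsUnit.mk0 _ hkσ.ne') _).1 hi
  · rw [← integral_const_mul, integral_eq_lintegral_of_nonneg_ae (Eventually.of_forall h0)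
      hm.aestronglyMeasurable, hl, ENNReal.toReal_ofReal (hF r hr).2]

/-- Integrals over the circle as integrals over `[-π, π]`, with the orientation reversed. -/
lemma intervalIntegral_of_circleLaw {f : ℂ → ℝ} (hm : Measurable fun v : Circle => f (v : ℂ)⁻¹)
    (hf : Integrable (fun v : Circle => f (v : ℂ)⁻¹) circleLaw) :
    IntervalIntegrable (fun s : ℝ => f (Complex.exp (s * Complex.I))) volume
      (-Real.pi) Real.pi ∧
    ∫ s in (-Real.pi)..Real.pi, f (Complex.exp (s * Complex.I)) / (2 * Real.pi) =
      ∫ v, f (v : ℂ)⁻¹ ∂circleLaw := by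
  have hpi := Real.pi_pos
  have hle : -Real.pi ≤ Real.pi := by linarith
  have hexp : ∀ s : ℝ, ((Circle.exp s : Circle) : ℂ)⁻¹ = Complex.exp ((-s : ℝ) * Complex.I) := by
    intro s
    rw [Circle.coe_exp, ← Complex.exp_neg]
    push_cast
    ring_nf
  have hc0 : (ENNReal.ofReal (2 * Real.pi))⁻¹ ≠ 0 :=
    ENNReal.inv_ne_zero.2 ENNReal.ofReal_ne_top
  have hc1 : (ENNReal.ofReal (2 * Real.pi))⁻¹ ≠ ⊤ :=
    ENNReal.inv_ne_top.2 (ENNReal.ofReal_pos.2 Real.two_pi_pos).ne'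
  rw [circleLaw, integrable_map_measure hm.aestronglyMeasurable measurable_circleExp.aemeasurable,
    volume_cond_Icc, integrable_smul_measure hc0 hc1] at hf
  have h1 : IntervalIntegrable (fun s : ℝ => f (Complex.exp ((-s : ℝ) * Complex.I))) volume
      (-Real.pi) Real.pi := by
    rw [intervalIntegrable_iff_integrableOn_Ioc_of_le hle]
    exact hf.congr (Eventually.of_forall fun s => by simp only [Function.comp_apply, hexp])
  constructor
  · have h2 := ((IntervalIntegrable.iff_comp_neg
      (f := fun s : ℝ => f (Complex.exp (s * Complex.I))) (a := Real.pi) (b := -Real.pi)).2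
        (by simpa using h1))
    exact h2.symm
  · rw [circleLaw, integral_map measurable_circleExp.aemeasurable hm.aestronglyMeasurable,
      volume_cond_Icc, integral_smul_measure, intervalIntegral.integral_div]
    have h3 := intervalIntegral.integral_comp_neg (a := -Real.pi) (b := Real.pi)
      (fun s : ℝ => f (Complex.exp (s * Complex.I)))
    rw [neg_neg] at h3
    rw [← h3, intervalIntegral.integral_of_le hle]
    simp only [hexp]
    rw [ENNReal.toReal_inv, ENNReal.toReal_ofReal (by positivity), smul_eq_mul, div_eq_inv_mul]

end moment

end Snowflake

theorem mainTheorem5 {Ω : Type*} [MeasurableSpace Ω]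
    (P : MeasureTheory.Measure Ω) [MeasureTheory.IsProbabilityMeasure P]
    (φ : ℂ → ℂ) (hφ : Snowflake.IsSigma φ) (k : ℕ) (hk : 2 ≤ k)
    (θ : ℕ → Ω → ℝ) (hmeas : ∀ n, Measurable (θ n)) (hindep : ProbabilityTheory.iIndepFun θ P)
    (hunif : ∀ n, MeasureTheory.pdf.IsUniform (θ n) (Set.Icc (-Real.pi) Real.pi) P
      MeasureTheory.volume)
    (t β τ σ : ℝ) (hτ : τ = 2 - t) (hσ : σ = β - 1)
    (F : ℝ → ℝ)
    (hF : ∀ r : ℝ, 1 < r → Snowflake.moment P φ k θ τ σ r = ENNReal.ofReal (F r) ∧ 0 ≤ F r)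
    (hFL : Snowflake.IsClassL F) :
    ∀ r : ℝ, 1 < r →
      IntervalIntegrable
        (fun s : ℝ => Snowflake.pullback φ k τ F (r * Complex.exp (s * Complex.I)))
        MeasureTheory.volume (-Real.pi) Real.pi ∧
      F r = 1 / (k : ℝ) ^ σ * ∫ s in (-Real.pi)..Real.pi,
        Snowflake.pullback φ k τ F (r * Complex.exp (s * Complex.I)) / (2 * Real.pi) ∧
      (k : ℝ) ^ β * F r = Snowflake.opQ φ k τ F r := by
  intro r hr
  obtain ⟨ℓ, h⟩ := hφ.exists_isLog
  have hF' : ∀ r : ℝ, 1 < r →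
      Snowflake.planeMoment ℓ k τ σ r = ENNReal.ofReal (F r) ∧ 0 ≤ F r := by
    intro r hr
    rw [← Snowflake.moment_eq_planeMoment P hφ h hk θ hmeas hindep hunif]
    exact hF r hr
  obtain ⟨hi, he⟩ := Snowflake.integrable_integral_pullback hφ h hk τ σ hF' hr
  obtain ⟨hii, hie⟩ := Snowflake.intervalIntegral_of_circleLaw
    (f := fun x => Snowflake.pullback φ k τ F (r * x))
    (Snowflake.measurable_pullback_circle hφ h hk τ σ hF' r) hi
  have hk0 : (0 : ℝ) < k := by exact_mod_cast (show 0 < k by omega)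
  have hkσ := Real.rpow_pos_of_pos hk0 σ
  have hmain : F r = 1 / (k : ℝ) ^ σ * ∫ s in (-Real.pi)..Real.pi,
      Snowflake.pullback φ k τ F (r * Complex.exp (s * Complex.I)) / (2 * Real.pi) := by
    rw [hie, ← he, Real.rpow_neg hk0.le, one_div]
  refine ⟨hii, hmain, ?_⟩
  -- Since `β = σ + 1`, the extra power of `k` is the prefactor of `Q`.
  rw [Snowflake.opQ, hmain, show β = σ + 1 by linarith, Real.rpow_add_one hk0.ne', one_div,
    mul_comm ((k : ℝ) ^ σ), mul_assoc, mul_inv_cancel_left₀ hkσ.ne']
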